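/- Theorem 1.1. Let $(M,g)$ be a compact, connected, smooth Riemannian manifold of dimension $m$ without boundary, with volume density $|dV_g|$. Let $\boldsymbol V\subset C^\infty(M)$ be a vector subspace of finite dimension $N$ equipped with a Euclidean inner product $(-,-)$, and let $S(\boldsymbol V)$ be its unit sphere, with area density $|dS|$. Assume that $\boldsymbol V$ is ample: for every $x\in M$ the linear map $\boldsymbol V\ni v\mapsto d_xv\in T_x^*M$ is surjective. For $v\in\boldsymbol V$ let $\mu_M(v)\in\{0,1,2,\dots,\infty\}$ be the number of critical points of $v$ on $M$, and let $$\mu(M,\boldsymbol V):=\frac{1}{\mathrm{area}(S(\boldsymbol V))}\int_{S(\boldsymbol V)}\mu_M(v)\,|dS(v)|$$ be the expected number of critical points of a random function from $S(\boldsymbol V)$. For $x\in M$ let $K_x=\{v\in\boldsymbol V:\ d_xv=0\}$, a subspace of codimension $m$ with unit sphere $S(K_x)$, let $K_x^\perp$ be its orthogonal complement in $\boldsymbol V$, and let $\Xi_x:T_xM\otimes K_x^\perp\to K_x$ be the shape operator of the bundle $K^\perp\subset\boldsymbol V\times M$, i.e. the differential at $x$ of the Gauss map $y\mapsto K_y^\perp$: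 for a smooth section $u$ of $K^\perp$ and $X\in T_xM$, $\Xi_x(X,u(x))$ is the orthogonal projection onto $K_x$ of the derivative $D_Xu\in\boldsymbol V$ of $u: M\to\boldsymbol V$ along $X$. For $v\in K_x$ let $|\det\Xi_x\cdot v|$ be the absolute value of the determinant of the $m\times m$ matrix $\big(\,(\Xi_x(e_i,u_j),v)\,\big)_{i,j}$, where $(e_i)$ is any $g$-orthonormal basis of $T_xM$ and $(u_j)$ is any orthonormal basis of $K_x^\perp$ (it does not depend on the bases). Then $\mu_M$ and $x\mapsto\int_{S(K_x)}|\det\Xi_x\cdot v|\,|dS(v)|$ are measurable up to null sets, $\mu(M,\boldsymbol V)$ is finite, and $$\mu(M,\boldsymbol V)=\frac{1}{\boldsymbol\sigma_{N-1}}\int_M\Big(\int_{S(K_x)}|\det\Xi_x\cdot v|\,|dS(v)|\Big)|dV_g(x)|,$$ where $\boldsymbol\sigma_{N-1}$ is the area of the unit sphere $S^{N-1}\subset\mathbb R^N$. -/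

import Mathlib

open MeasureTheory Metric Set Bundle Manifold ContDiff
open scoped ENNReal InnerProductSpace

noncomputable section

/-- The area measure on the unit sphere `S(F)` of a Euclidean space `F`. -/
def sphereMeasure (F : Type*) [NormedAddCommGroup F] [InnerProductSpace ℝ F]
    [FiniteDimensional ℝ F] [MeasurableSpace F] [BorelSpace F] : Measure (sphere (0 : F) 1) :=
  (volume : Measure F).toSphere

/-- The area `σ_{n-1}` of the unit sphere `S^{n-1}` of `ℝ^n`. -/
def unitSphereArea (n : ℕ) : ℝ≥0∞ := sphereMeasure (EuclideanSpace ℝ (Fin n)) univ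

section Volume

variable {m : ℕ} {M : Type*} [TopologicalSpace M] [ChartedSpace (EuclideanSpace ℝ (Fin m)) M]
  [RiemannianBundle (fun x : M ↦ TangentSpace (𝓡 m) x)]

/-- The `i`-th coordinate vector field `∂_i` of the chart at `x₀`, at the point of `M` with
coordinates `y`. -/
def coordField (x₀ : M) (y : EuclideanSpace ℝ (Fin m)) (i : Fin m) :
    TangentSpace (𝓡 m) ((extChartAt (𝓡 m) x₀).symm y) :=
  mfderiv 𝓘(ℝ, EuclideanSpace ℝ (Fin m)) (𝓡 m) (extChartAt (𝓡 m) x₀).symm y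
    (EuclideanSpace.single i (1 : ℝ))

/-- The density `√(det g(∂_i, ∂_j))` of the Riemannian volume in the chart at `x₀`. -/
def volumeDensity (x₀ : M) (y : EuclideanSpace ℝ (Fin m)) : ℝ :=
  √(Matrix.gram ℝ (coordField x₀ y)).det

variable [MeasurableSpace M]

/-- The Riemannian volume on the domain of the chart at `x₀`, extended by zero. -/
def chartVolume (x₀ : M) : Measure M :=
  (((volume : Measure (EuclideanSpace ℝ (Fin m))).restrict
    (extChartAt (𝓡 m) x₀).target).withDensity
      (fun y ↦ ENNReal.ofReal (volumeDensity x₀ y))).map (extChartAt (𝓡 m) x₀).symm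

variable (m M) in
/-- The Riemannian volume: the smallest measure dominating `√(det g(∂_i, ∂_j)) dy` in each chart.
As those measures coincide on the overlaps of charts, it is the one that restricts to
`√(det g(∂_i, ∂_j)) dy` on the domain of each chart. -/
def riemannianVolume : Measure M := ⨆ x₀ : M, chartVolume (m := m) x₀

end Volume

section SampleSpace

variable {m : ℕ} {M : Type*} [TopologicalSpace M] [ChartedSpace (EuclideanSpace ℝ (Fin m)) M]

/-- A vector space `V` of smooth functions, with the Euclidean metric `h`. -/
def SampleSpace (V : Submodule ℝ C^∞⟮𝓡 m, M; ℝ⟯) (_h : InnerProductSpace.Core ℝ V) : Type _ := V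

namespace SampleSpace

variable (V : Submodule ℝ C^∞⟮𝓡 m, M; ℝ⟯) (h : InnerProductSpace.Core ℝ V)

instance : NormedAddCommGroup (SampleSpace V h) := h.toNormedAddCommGroup

instance : InnerProductSpace ℝ (SampleSpace V h) := InnerProductSpace.ofCore h.toCore

instance [FiniteDimensional ℝ V] : FiniteDimensional ℝ (SampleSpace V h) :=
  inferInstanceAs (FiniteDimensional ℝ V)

instance : MeasurableSpace (SampleSpace V h) := borel _

instance : BorelSpace (SampleSpace V h) := ⟨rfl⟩

/-- The inclusion `V ⊂ C^∞(M)`. -/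
def incl : SampleSpace V h →ₗ[ℝ] C^∞⟮𝓡 m, M; ℝ⟯ := V.subtype

end SampleSpace

end SampleSpace


section ShapeOperator

/- A linear family `ι : E → C^∞(M)` of smooth functions, parametrized by a Euclidean space `E`. It
is used for the inclusion of a space of smooth functions that carries a Euclidean metric. -/
variable {m : ℕ} {M : Type*} [TopologicalSpace M] [ChartedSpace (EuclideanSpace ℝ (Fin m)) M]
  {E : Type*} [NormedAddCommGroup E] [InnerProductSpace ℝ E]
  (ι : E →ₗ[ℝ] C^∞⟮𝓡 m, M; ℝ⟯)

/-- The adjunction map `A_x : E → T*_x M`, `v ↦ d_x v`. -/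
def adjunction (x : M) : E →ₗ[ℝ] (TangentSpace (𝓡 m) x →L[ℝ] ℝ) where
  toFun v := mvfderiv (𝓡 m) (ι v) x
  map_add' v w := by
    rw [map_add, ContMDiffMap.coe_add]
    exact mvfderiv_add ((ι v).contMDiff.mdifferentiable (by simp) x)
      ((ι w).contMDiff.mdifferentiable (by simp) x)
  map_smul' c v := by
    have h := mvfderiv_smul (x := x) (a := fun _ : M ↦ c) (I := 𝓡 m)
      (mdifferentiableAt_const) ((ι v).contMDiff.mdifferentiable (by simp) x)
    rw [map_smul, ContMDiffMap.coe_smul]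
    refine Eq.trans h ?_
    rw [mvfderiv_const]
    ext X
    simp

/-- Ampleness: every covector of `M` is the differential of a function of the family. -/
def IsAmple : Prop := ∀ x : M, Function.Surjective (adjunction ι x)

/-- The space `K_x` of the functions that are critical at `x`. -/
def criticalSpace (x : M) : Submodule ℝ E := (adjunction ι x).ker

/-- The number of critical points of `v`, in `{0, 1, 2, …, ∞}`. -/
def numCritical (v : E) : ℕ∞ := {x : M | v ∈ criticalSpace ι x}.encard

variable [FiniteDimensional ℝ E]

/-- The Gauss map `x ↦ K_x^⊥`, where a subspace of `E` is represented by the orthogonal projection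
onto it. -/
def gaussMap (x : M) : E →L[ℝ] E := (criticalSpace ι x)ᗮ.starProjection

/-- The shape operator `Ξ_x : T_x M × K_x^⊥ → K_x` of the bundle `K^⊥`, i.e. the differential of the
Gauss map: `Ξ_x(X, u)` is the component in `K_x` of the derivative along `X` of the section
`y ↦ gaussMap y u` of `K^⊥`, whose value at `x` is `u`. By `shapeOperator_section` any other section
of `K^⊥` through `u` gives the same result. -/
def shapeOperator (x : M) :
    TangentSpace (𝓡 m) x →ₗ[ℝ] (criticalSpace ι x)ᗮ →ₗ[ℝ] criticalSpace ι x :=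
  LinearMap.mk₂ ℝ
    (fun X u ↦ (criticalSpace ι x).orthogonalProjectionOnto
      (mvfderiv (𝓡 m) (gaussMap ι) x X (u : E)))
    (by intros; simp) (by intros; simp) (by intros; simp) (by intros; simp)


/-- The projection onto the orthogonal complement of a kernel, in terms of a map `T` onto it. -/
theorem starProjection_orthogonal_eq {F : Type*} [NormedAddCommGroup F] [NormedSpace ℝ F]
    [FiniteDimensional ℝ F] (K : Submodule ℝ E) (T : F →L[ℝ] E) (hT : Function.Injective T)
    (hK : ∀ v, v ∈ K ↔ ∀ w, ⟪v, T w⟫_ℝ = 0) :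
    (∃ e : F ≃L[ℝ] (F →L[ℝ] ℝ), (e : F →L[ℝ] (F →L[ℝ] ℝ)) =
      ((ContinuousLinearMap.compL ℝ F E ℝ).flip T ∘L innerSL ℝ) ∘L T) ∧
    Kᗮ.starProjection = T ∘L (((ContinuousLinearMap.compL ℝ F E ℝ).flip T ∘L innerSL ℝ) ∘L
      T).inverse ∘L ((ContinuousLinearMap.compL ℝ F E ℝ).flip T ∘L innerSL ℝ) := by
  set A : E →L[ℝ] (F →L[ℝ] ℝ) := (ContinuousLinearMap.compL ℝ F E ℝ).flip T ∘L innerSL ℝ with hA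
  have hAv : ∀ v w, A v w = ⟪v, T w⟫_ℝ := fun v w ↦ rfl
  have hinj : Function.Injective (A ∘L T) := by
    refine (injective_iff_map_eq_zero _).2 fun w hw ↦ hT ?_
    have := DFunLike.congr_fun hw w
    rw [map_zero, ← inner_self_eq_zero (𝕜 := ℝ), ← hAv]
    exact this
  have hfr : Module.finrank ℝ F = Module.finrank ℝ (F →L[ℝ] ℝ) := by
    have L : (F →ₗ[ℝ] ℝ) ≃ₗ[ℝ] (F →L[ℝ] ℝ) := LinearMap.toContinuousLinearMap
    rw [← L.finrank_eq]
    exact Subspace.dual_finrank_eq.symm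
  obtain ⟨e, he⟩ : ∃ e : F ≃L[ℝ] (F →L[ℝ] ℝ), (e : F →L[ℝ] (F →L[ℝ] ℝ)) = A ∘L T :=
    ⟨(LinearEquiv.ofInjectiveOfFinrankEq (A ∘L T).toLinearMap hinj hfr).toContinuousLinearEquiv,
      by ext; rfl⟩
  refine ⟨⟨e, he⟩, ?_⟩
  ext u
  rw [← he, ContinuousLinearMap.inverse_equiv]
  refine Submodule.eq_starProjection_of_mem_orthogonal ?_ ?_
  · exact (Submodule.mem_orthogonal _ _).2 fun v hv ↦ (hK v).1 hv _
  · rw [Submodule.orthogonal_orthogonal]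
    refine (hK _).2 fun w ↦ ?_
    have h1 : A (T (e.symm (A u))) = A u := by
      change (A ∘L T) _ = _
      rw [← he]
      simp
    have h2 : A (u - T (e.symm (A u))) = 0 := by rw [map_sub, h1, sub_self]
    rw [← hAv]
    exact DFunLike.congr_fun h2 w

variable {ι} [IsManifold (𝓡 m) ∞ M]

theorem IsAmple.mdifferentiableAt_gaussMap (hι : IsAmple ι) (x : M) :
    MDifferentiableAt (𝓡 m) 𝓘(ℝ, E →L[ℝ] E) (gaussMap ι) x := by
  set φ := extChartAt (𝓡 m) x with hφ
  have hopen : IsOpen φ.target := isOpen_extChartAt_target x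
  let b := stdOrthonormalBasis ℝ E
  let G : EuclideanSpace ℝ (Fin m) → E := fun z ↦ ∑ a, ι (b a) (φ.symm z) • b a
  have hf : ∀ v : E, ContDiffOn ℝ ∞ (fun z ↦ ι v (φ.symm z)) φ.target := fun v ↦
    contMDiffOn_iff_contDiffOn.1
      ((ι v).contMDiff.comp_contMDiffOn (contMDiffOn_extChartAt_symm x))
  have hG : ContDiffOn ℝ ∞ G φ.target :=
    ContDiffOn.sum fun a _ ↦ (hf (b a)).smul contDiffOn_const
  have hinner : ∀ (v : E) (z), ⟪v, G z⟫_ℝ = ι v (φ.symm z) := by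
    intro v z
    let l : E →ₗ[ℝ] ℝ :=
      { toFun := fun v ↦ ι v (φ.symm z)
        map_add' := fun v w ↦ by rw [map_add, ContMDiffMap.coe_add, Pi.add_apply]
        map_smul' := fun c v ↦ by rw [map_smul, ContMDiffMap.coe_smul, Pi.smul_apply]; rfl }
    change _ = l v
    conv_rhs => rw [← b.sum_repr' v]
    simp only [G, inner_sum, inner_smul_right, map_sum, map_smul]
    refine Finset.sum_congr rfl fun a _ ↦ ?_
    rw [smul_eq_mul, mul_comm, real_inner_comm]
    rfl
  have hT : ∀ z ∈ φ.target, ∀ v w, ⟪v, fderiv ℝ G z w⟫_ℝ = adjunction ι (φ.symm z) v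
      (mfderiv 𝓘(ℝ, EuclideanSpace ℝ (Fin m)) (𝓡 m) φ.symm z w) := by
    intro z hz v w
    have hGz : DifferentiableAt ℝ G z :=
      (hG.contDiffAt (hopen.mem_nhds hz)).differentiableAt (by simp)
    have h1 : fderiv ℝ (fun z ↦ ⟪v, G z⟫_ℝ) z w = ⟪v, fderiv ℝ G z w⟫_ℝ := by
      have := ((innerSL ℝ v).hasFDerivAt.comp z hGz.hasFDerivAt).fderiv
      exact DFunLike.congr_fun this w
    rw [← h1]
    simp only [hinner]
    have h2 := mvfderiv_comp_apply z ((ι v).contMDiff.mdifferentiable (by simp) (φ.symm z))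
      (((contMDiffOn_extChartAt_symm (I := 𝓡 m) (n := ∞) x).contMDiffAt
        (hopen.mem_nhds hz)).mdifferentiableAt (by simp)) w
    refine Eq.trans ?_ h2
    rw [mvfderiv, mfderiv_eq_fderiv]
    rfl
  have hsurj : ∀ z ∈ φ.target, Function.Bijective
      (mfderiv 𝓘(ℝ, EuclideanSpace ℝ (Fin m)) (𝓡 m) φ.symm z) := by
    intro z hz
    have := isInvertible_mfderivWithin_extChartAt_symm (I := 𝓡 m) hz
    rw [ModelWithCorners.range_eq_univ, mfderivWithin_univ] at this
    exact this.bijective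
  have hTinj : ∀ z ∈ φ.target, Function.Injective (fderiv ℝ G z) := by
    intro z hz
    refine (injective_iff_map_eq_zero _).2 fun w hw ↦ (hsurj z hz).1 ?_
    have h0 : ∀ ξ : EuclideanSpace ℝ (Fin m) →L[ℝ] ℝ,
        ξ (mfderiv 𝓘(ℝ, EuclideanSpace ℝ (Fin m)) (𝓡 m) φ.symm z w) = 0 := by
      intro ξ
      obtain ⟨v, hv⟩ := hι (φ.symm z) ξ
      have := hT z hz v w
      rw [hw, inner_zero_right, hv] at this
      exact this.symm
    have h1 : ∀ X : EuclideanSpace ℝ (Fin m),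
        (∀ ξ : EuclideanSpace ℝ (Fin m) →L[ℝ] ℝ, ξ X = 0) → X = 0 := fun X hX ↦
      (inner_self_eq_zero (𝕜 := ℝ)).1 (hX (innerSL ℝ X))
    exact (h1 _ h0).trans (ContinuousLinearMap.map_zero
      (mfderiv 𝓘(ℝ, EuclideanSpace ℝ (Fin m)) (𝓡 m) φ.symm z)).symm
  have hK : ∀ y ∈ φ.source, ∀ v, v ∈ criticalSpace ι y ↔ ∀ w, ⟪v, fderiv ℝ G (φ y) w⟫_ℝ = 0 := by
    intro y hy v
    obtain ⟨z, hz, rfl⟩ : ∃ z ∈ φ.target, φ.symm z = y := ⟨φ y, φ.map_source hy, φ.left_inv hy⟩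
    rw [φ.right_inv hz]
    simp only [hT _ hz]
    constructor
    · intro hv w
      exact DFunLike.congr_fun (LinearMap.mem_ker.1 hv) _
    · intro hv
      refine LinearMap.mem_ker.2 (ContinuousLinearMap.ext fun X ↦ ?_)
      obtain ⟨w, rfl⟩ := (hsurj z hz).2 X
      exact hv w
  have hev : gaussMap ι =ᶠ[nhds x] fun y ↦ (fun T : EuclideanSpace ℝ (Fin m) →L[ℝ] E ↦
      T ∘L (((ContinuousLinearMap.compL ℝ _ E ℝ).flip T ∘L innerSL ℝ) ∘L T).inverse ∘L
        ((ContinuousLinearMap.compL ℝ _ E ℝ).flip T ∘L innerSL ℝ)) (fderiv ℝ G (φ y)) := by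
    filter_upwards [extChartAt_source_mem_nhds (I := 𝓡 m) x] with y hy
    exact (starProjection_orthogonal_eq _ _ (hTinj _ (φ.map_source hy)) (hK y hy)).2
  have hx := mem_extChartAt_source (I := 𝓡 m) x
  refine MDifferentiableAt.congr_of_eventuallyEq ?_ hev
  have hd : MDifferentiableAt (𝓡 m) 𝓘(ℝ, EuclideanSpace ℝ (Fin m) →L[ℝ] E)
      (fun y ↦ fderiv ℝ G (φ y)) x := by
    have : DifferentiableAt ℝ (fderiv ℝ G) (φ x) :=
      ((hG.contDiffAt (hopen.mem_nhds (φ.map_source hx))).fderiv_right (m := 1)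
        (by norm_cast)).differentiableAt (by simp)
    exact this.comp_mdifferentiableAt (mdifferentiableAt_extChartAt (mem_chart_source _ x))
  refine DifferentiableAt.comp_mdifferentiableAt (g := fun T : EuclideanSpace ℝ (Fin m) →L[ℝ] E ↦
      T ∘L (((ContinuousLinearMap.compL ℝ _ E ℝ).flip T ∘L innerSL ℝ) ∘L T).inverse ∘L
        ((ContinuousLinearMap.compL ℝ _ E ℝ).flip T ∘L innerSL ℝ)) ?_ hd
  obtain ⟨e, he⟩ := (starProjection_orthogonal_eq _ _ (hTinj _ (φ.map_source hx)) (hK x hx)).1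
  have hA : DifferentiableAt ℝ (fun T : EuclideanSpace ℝ (Fin m) →L[ℝ] E ↦
      (ContinuousLinearMap.compL ℝ _ E ℝ).flip T ∘L innerSL ℝ) (fderiv ℝ G (φ x)) := by
    fun_prop
  refine differentiableAt_id.clm_comp (DifferentiableAt.clm_comp ?_ hA)
  refine DifferentiableAt.comp (g := ContinuousLinearMap.inverse)
    (f := fun T : EuclideanSpace ℝ (Fin m) →L[ℝ] E ↦
      ((ContinuousLinearMap.compL ℝ _ E ℝ).flip T ∘L innerSL ℝ) ∘L T) _ ?_
    (hA.clm_comp differentiableAt_id)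
  change DifferentiableAt ℝ _ (((ContinuousLinearMap.compL ℝ _ E ℝ).flip (fderiv ℝ G (φ x)) ∘L
    innerSL ℝ) ∘L (fderiv ℝ G (φ x)))
  rw [← he]
  exact (contDiffAt_map_inverse (n := 1) e).differentiableAt (by simp)

/-- For every section `u` of `K^⊥`, one has `Ξ(X, u) = (D_X u)^0`. -/
theorem shapeOperator_section (hι : IsAmple ι) (x : M) (X : TangentSpace (𝓡 m) x)
    (u : ∀ y : M, (criticalSpace ι y)ᗮ)
    (hu : MDifferentiableAt (𝓡 m) 𝓘(ℝ, E) (fun y ↦ (u y : E)) x) :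
    shapeOperator ι x X (u x) =
      (criticalSpace ι x).orthogonalProjectionOnto (mvfderiv (𝓡 m) (fun y ↦ (u y : E)) x X) := by
  have hP := hι.mdifferentiableAt_gaussMap x
  have hPu : (fun y ↦ gaussMap ι y (u y)) = fun y ↦ (u y : E) := by
    ext y
    exact Submodule.starProjection_eq_self_iff.2 (u y).2
  have hD : mvfderiv (𝓡 m) (fun y ↦ (u y : E)) x X =
      mvfderiv (𝓡 m) (gaussMap ι) x X (u x) +
        gaussMap ι x (mvfderiv (𝓡 m) (fun y ↦ (u y : E)) x X) := by
    have hPu' : MDifferentiableAt (𝓡 m) 𝓘(ℝ, E) (fun y ↦ gaussMap ι y (u y)) x := by rwa [hPu]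
    have h1 := hP.differentiableWithinAt_writtenInExtChartAt
    have h2 := hu.differentiableWithinAt_writtenInExtChartAt
    rw [ModelWithCorners.range_eq_univ, differentiableWithinAt_univ] at h1 h2
    conv_lhs => rw [← hPu, hPu'.mvfderiv]
    rw [hu.mvfderiv, hP.mvfderiv, ModelWithCorners.range_eq_univ, fderivWithin_univ,
      fderivWithin_univ, fderivWithin_univ]
    have h3 := DFunLike.congr_fun (fderiv_clm_apply h1 h2) X
    refine Eq.trans h3 ?_
    have h4 : writtenInExtChartAt (𝓡 m) 𝓘(ℝ, E →L[ℝ] E) x (gaussMap ι) (extChartAt (𝓡 m) x x) =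
        gaussMap ι x := congrArg (gaussMap ι) (extChartAt_to_inv x)
    have h5 : writtenInExtChartAt (𝓡 m) 𝓘(ℝ, E) x (fun y ↦ (u y : E)) (extChartAt (𝓡 m) x x) =
        u x := congrArg (fun y ↦ (u y : E)) (extChartAt_to_inv x)
    rw [h4, h5]
    exact add_comm _ _
  have h0 : (criticalSpace ι x).orthogonalProjectionOnto
      (gaussMap ι x (mvfderiv (𝓡 m) (fun y ↦ (u y : E)) x X)) = 0 :=
    Submodule.orthogonalProjectionOnto_eq_zero_iff.2 (Submodule.starProjection_apply_mem _ _)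
  conv_rhs => rw [hD, map_add, h0, add_zero]
  rfl

end ShapeOperator

section Determinant

variable {m : ℕ} {M : Type*} [TopologicalSpace M] [ChartedSpace (EuclideanSpace ℝ (Fin m)) M]
  {E : Type*} [NormedAddCommGroup E] [InnerProductSpace ℝ E] [FiniteDimensional ℝ E]
  {ι : E →ₗ[ℝ] C^∞⟮𝓡 m, M; ℝ⟯}

instance (x : M) : FiniteDimensional ℝ (TangentSpace (𝓡 m) x) :=
  inferInstanceAs (FiniteDimensional ℝ (EuclideanSpace ℝ (Fin m)))

theorem finrank_tangentSpace_eq (x : M) : Module.finrank ℝ (TangentSpace (𝓡 m) x) = m :=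
  finrank_euclideanSpace_fin

theorem IsAmple.finrank_orthogonal (hι : IsAmple ι) (x : M) :
    Module.finrank ℝ (criticalSpace ι x)ᗮ = m := by
  have h1 := (adjunction ι x).finrank_range_add_finrank_ker
  have h2 := (criticalSpace ι x).finrank_add_finrank_orthogonal
  rw [LinearMap.range_eq_top.2 (hι x), finrank_top] at h1
  have h3 : Module.finrank ℝ (TangentSpace (𝓡 m) x →L[ℝ] ℝ) = m := by
    have : T2Space (TangentSpace (𝓡 m) x) :=
      inferInstanceAs (T2Space (EuclideanSpace ℝ (Fin m)))
    have L : (TangentSpace (𝓡 m) x →ₗ[ℝ] ℝ) ≃ₗ[ℝ] (TangentSpace (𝓡 m) x →L[ℝ] ℝ) :=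
      LinearMap.toContinuousLinearMap
    rw [← L.finrank_eq]
    exact Subspace.dual_finrank_eq.trans (finrank_tangentSpace_eq x)
  change Module.finrank ℝ (criticalSpace ι x) + _ = _ at h2
  change _ + Module.finrank ℝ (criticalSpace ι x) = _ at h1
  omega

variable [RiemannianBundle (fun x : M ↦ TangentSpace (𝓡 m) x)]

/-- The matrix `Ξ_x(e_i, u_j) · v` of the bilinear form `Ξ_x · v` on `T_x M × K_x^⊥` in the
bases `e` and `u`. -/
def shapeMatrix (ι : E →ₗ[ℝ] C^∞⟮𝓡 m, M; ℝ⟯) (x : M)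
    (e : OrthonormalBasis (Fin m) ℝ (TangentSpace (𝓡 m) x))
    (u : OrthonormalBasis (Fin m) ℝ (criticalSpace ι x)ᗮ) (v : criticalSpace ι x) :
    Matrix (Fin m) (Fin m) ℝ :=
  Matrix.of fun i j ↦ ⟪shapeOperator ι x (e i) (u j), v⟫_ℝ

/-- The number `|det Ξ_x · v|`, computed in some orthonormal bases of `T_x M` and of `K_x^⊥`.
It does not depend on them, see `absDetShape_eq`. -/
def absDetShape (hι : IsAmple ι) (x : M) (v : criticalSpace ι x) : ℝ :=
  |(shapeMatrix ι x
    ((stdOrthonormalBasis ℝ (TangentSpace (𝓡 m) x)).reindex (finCongr (finrank_tangentSpace_eq x)))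
    ((stdOrthonormalBasis ℝ (criticalSpace ι x)ᗮ).reindex (finCongr (hι.finrank_orthogonal x)))
    v).det|

theorem absDetShape_eq (hι : IsAmple ι) (x : M) (v : criticalSpace ι x)
    (e : OrthonormalBasis (Fin m) ℝ (TangentSpace (𝓡 m) x))
    (u : OrthonormalBasis (Fin m) ℝ (criticalSpace ι x)ᗮ) :
    absDetShape hι x v = |(shapeMatrix ι x e u v).det| := by
  have key : ∀ (e e' : OrthonormalBasis (Fin m) ℝ (TangentSpace (𝓡 m) x))
      (u u' : OrthonormalBasis (Fin m) ℝ (criticalSpace ι x)ᗮ),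
      |(shapeMatrix ι x e' u' v).det| = |(shapeMatrix ι x e u v).det| := by
    intro e e' u u'
    have hB : ∀ (e : OrthonormalBasis (Fin m) ℝ (TangentSpace (𝓡 m) x))
        (u : OrthonormalBasis (Fin m) ℝ (criticalSpace ι x)ᗮ),
        shapeMatrix ι x e u v = LinearMap.toMatrix₂ e.toBasis u.toBasis
          ((shapeOperator ι x).compr₂ (innerₗ _ v)) := by
      intro e u
      ext i j
      simp [shapeMatrix, LinearMap.toMatrix₂_apply, real_inner_comm]
    rw [hB, hB, ← LinearMap.toMatrix₂_mul_basis_toMatrix e.toBasis u.toBasis e'.toBasis u'.toBasis,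
      Matrix.det_mul, Matrix.det_mul, Matrix.det_transpose, abs_mul, abs_mul]
    have h1 : |(e.toBasis.toMatrix e').det| = 1 := e.det_to_matrix_orthonormalBasis e'
    have h2 : |(u.toBasis.toMatrix u').det| = 1 := u.det_to_matrix_orthonormalBasis u'
    simp only [OrthonormalBasis.coe_toBasis, h1, h2, one_mul, mul_one]
  exact key _ _ _ _

end Determinant

/-- The expected number of critical points of a random function of the family `ι`, with parameter
uniformly distributed in the unit sphere `S(E)`. -/
def expectedCritical {m : ℕ} {M : Type*} [TopologicalSpace M]
    [ChartedSpace (EuclideanSpace ℝ (Fin m)) M]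
    {E : Type*} [NormedAddCommGroup E] [InnerProductSpace ℝ E] [FiniteDimensional ℝ E]
    [MeasurableSpace E] [BorelSpace E] (ι : E →ₗ[ℝ] C^∞⟮𝓡 m, M; ℝ⟯) : ℝ≥0∞ :=
  (sphereMeasure E univ)⁻¹ * ∫⁻ v, (numCritical ι (v : E) : ℝ≥0∞) ∂(sphereMeasure E)

end

/-! ### The area formula with multiplicities -/

section AreaFormula

open scoped NNReal

/-! Ampleness makes the spaces `K_x` fibres of a vector bundle of rank `N - m` over `M`, so the
incidence set of pairs `(x, v)` with `v ∈ K_x` has dimension `m + (N - m) = N`. Its projection to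
the space of functions is a map between spaces of equal dimension, and the fibre over `v` is the
critical set of `v`. The area formula `lintegral_encard_fiber` turns the integral of the fibre count
into the integral of the Jacobian; critical values form a null set, so no properness or Morse
condition is needed.

Locally, take orthonormal frames `A` of `K^⊥` and `B` of `K` in a chart and parametrize the
incidence set by `(z, c) ↦ B z c`. The derivative in `c` is an isometry onto `K`, so only the
`K^⊥`-component of the derivative in `z` contributes. Differentiating `⟪A a, B c⟫ = 0` gives this
component as `-⟪D_i A e_j, B c⟫`, the shape operator paired with `v = B c`
(`IsFramePair.abs_det_fderiv`). Replacing coordinate vectors by an orthonormal tangent basis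
produces exactly the density of the Riemannian volume
(`IsCriticalFrame.volumeDensity_mul_absDetShape`).

The area formula lives on unit balls, the theorem on unit spheres. The count is homogeneous of
degree `0` in dimension `N`, the determinant of degree `m` in dimension `N - m`; in polar
coordinates both give the factor `N` (`lintegral_toSphere_of_homogeneous`), which cancels. The balls
are punctured so that this also holds in dimension zero, where the origin is not a null set.

Continuity of the Jacobian on compact pieces gives finiteness, and compactness of `M` assembles the
local formulas (`IsAmple.criticalFormula_univ`). -/

/-- For the discrete σ-algebra, `encard` is the counting measure of every set, so countable
additivity applies. -/
theorem encard_iUnion_eq_tsum {α ι : Type*} [Countable ι] {s : ι → Set α}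
    (hs : Pairwise (Function.onFun Disjoint s)) :
    ((⋃ i, s i).encard : ℝ≥0∞) = ∑' i, ((s i).encard : ℝ≥0∞) := by
  let _ : MeasurableSpace α := ⊤
  simp only [← Measure.count_apply (MeasurableSpace.measurableSet_top)]
  exact measure_iUnion hs fun _ ↦ MeasurableSpace.measurableSet_top

variable {F : Type*} [NormedAddCommGroup F] [NormedSpace ℝ F] [FiniteDimensional ℝ F]
  [MeasurableSpace F] [BorelSpace F]

/-- A map that is Lipschitz-close to an invertible linear map `A`, with constant below `‖A⁻¹‖⁻¹`, is
injective. Differentiability alone provides a countable partition into pieces with such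
approximations. -/
theorem exists_partition_injOn_of_det_ne_zero {f : F → F} {s : Set F}
    (hf : ∀ x ∈ s, DifferentiableAt ℝ f x) (hdet : ∀ x ∈ s, (fderiv ℝ f x).det ≠ 0) :
    ∃ t : ℕ → Set F, Pairwise (Function.onFun Disjoint t) ∧ (∀ n, MeasurableSet (t n)) ∧
      s ⊆ ⋃ n, t n ∧ ∀ n, InjOn f (s ∩ t n) := by
  classical
  rcases s.eq_empty_or_nonempty with rfl | hne
  · refine ⟨fun _ ↦ ∅, fun _ _ _ ↦ by simp [Function.onFun], by simp, by simp, by simp⟩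
  let r : (F →L[ℝ] F) → ℝ≥0 := fun A ↦ if h : A.det ≠ 0 then
    (if Subsingleton F then 1
      else ‖((A.toContinuousLinearEquivOfDetNeZero h).symm : F →L[ℝ] F)‖₊⁻¹ / 2) else 1
  have hpos : ∀ A : F →L[ℝ] F, ∀ h : A.det ≠ 0, ¬ Subsingleton F →
      0 < ‖((A.toContinuousLinearEquivOfDetNeZero h).symm : F →L[ℝ] F)‖₊⁻¹ := by
    intro A h hF
    rcases (A.toContinuousLinearEquivOfDetNeZero h).subsingleton_or_nnnorm_symm_pos with h1 | h1
    · exact absurd h1 hF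
    · exact inv_pos.2 h1
  have rpos : ∀ A, r A ≠ 0 := by
    intro A
    by_cases h : A.det ≠ 0
    · by_cases hF : Subsingleton F
      · simp [r, hF]
      · simp only [r, h, hF, dite_true, if_false, not_false_eq_true, ne_eq]
        exact (half_pos (hpos A h hF)).ne'
    · simp only [r, h, dite_false, ne_eq, one_ne_zero, not_false_eq_true]
  obtain ⟨t, A, h1, h2, h3, h4, h5⟩ := exists_partition_approximatesLinearOn_of_hasFDerivWithinAt
    f s (fderiv ℝ f) (fun x hx ↦ (hf x hx).hasFDerivAt.hasFDerivWithinAt) r rpos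
  refine ⟨t, h1, h2, h3, fun n ↦ ?_⟩
  obtain ⟨y, hy, hA⟩ := h5 hne n
  have hd : (A n).det ≠ 0 := hA ▸ hdet y hy
  have h6 := h4 n
  have h7 : ApproximatesLinearOn f ((A n).toContinuousLinearEquivOfDetNeZero hd : F →L[ℝ] F)
      (s ∩ t n) (r (A n)) := by
    convert! h6
  refine h7.injOn ?_
  by_cases hF : Subsingleton F
  · exact Or.inl hF
  · right
    simp only [r, hd, hF, dite_true, if_false, not_false_eq_true, ne_eq]
    exact half_lt_self (hpos _ hd hF)

variable (μ : Measure F) [μ.IsAddHaarMeasure]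

/-- The area formula: the integral of the Jacobian counts the points of the fibers. -/
theorem lintegral_encard_fiber {f : F → F} {s : Set F} (hs : MeasurableSet s)
    (hf : ∀ x ∈ s, DifferentiableAt ℝ f x) :
    AEMeasurable (fun y ↦ ({x ∈ s | f x = y}.encard : ℝ≥0∞)) μ ∧
    ∫⁻ y, ({x ∈ s | f x = y}.encard : ℝ≥0∞) ∂μ =
      ∫⁻ x in s, ENNReal.ofReal |(fderiv ℝ f x).det| ∂μ := by
  have hmeas : Measurable fun x ↦ (fderiv ℝ f x).det :=
    ContinuousLinearMap.continuous_det.measurable.comp (measurable_fderiv ℝ f)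
  set s₀ := s ∩ {x | (fderiv ℝ f x).det = 0}
  set s₁ := s ∩ {x | (fderiv ℝ f x).det ≠ 0}
  have hs₁ : MeasurableSet s₁ := hs.inter (hmeas (measurableSet_singleton 0).compl)
  -- Sard's theorem in equal dimensions, where differentiability suffices.
  have hnull : μ (f '' s₀) = 0 := addHaar_image_eq_zero_of_det_fderivWithin_eq_zero μ
    (fun x hx ↦ (hf x hx.1).hasFDerivAt.hasFDerivWithinAt) fun x hx ↦ hx.2
  obtain ⟨t, hdisj, htm, hcov, hinj⟩ := exists_partition_injOn_of_det_ne_zero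
    (f := f) (s := s₁) (fun x hx ↦ hf x hx.1) fun x hx ↦ hx.2
  have hder : ∀ n, ∀ x ∈ s₁ ∩ t n, HasFDerivWithinAt f (fderiv ℝ f x) (s₁ ∩ t n) x :=
    fun n x hx ↦ (hf x hx.1.1).hasFDerivAt.hasFDerivWithinAt
  have himg : ∀ n, MeasurableSet (f '' (s₁ ∩ t n)) := fun n ↦
    measurable_image_of_fderivWithin (hs₁.inter (htm n)) (hder n) (hinj n)
  -- Away from the critical values, each injective piece contributes at most one point of the fibre,
  -- so the count is the sum of the indicators of the images.
  have hae : (fun y ↦ ({x ∈ s | f x = y}.encard : ℝ≥0∞)) =ᵐ[μ]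
      fun y ↦ ∑' n, (f '' (s₁ ∩ t n)).indicator 1 y := by
    have : ∀ᵐ y ∂μ, y ∉ f '' s₀ := measure_eq_zero_iff_ae_notMem.1 hnull
    filter_upwards [this] with y hy
    have hU : {x ∈ s | f x = y} = ⋃ n, {x ∈ s₁ ∩ t n | f x = y} := by
      ext x
      simp only [mem_iUnion, mem_sep_iff]
      constructor
      · rintro ⟨hx, rfl⟩
        have hx1 : x ∈ s₁ := ⟨hx, fun h0 ↦ hy ⟨x, ⟨hx, h0⟩, rfl⟩⟩
        obtain ⟨n, hn⟩ := mem_iUnion.1 (hcov hx1)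
        exact ⟨n, ⟨hx1, hn⟩, rfl⟩
      · rintro ⟨n, hx, rfl⟩
        exact ⟨hx.1.1, rfl⟩
    rw [hU, encard_iUnion_eq_tsum]
    · refine tsum_congr fun n ↦ ?_
      by_cases h : y ∈ f '' (s₁ ∩ t n)
      · obtain ⟨x, hx, rfl⟩ := h
        have : {x' ∈ s₁ ∩ t n | f x' = f x} = {x} := by
          ext x'
          exact ⟨fun h ↦ hinj n h.1 hx h.2, by rintro rfl; exact ⟨hx, rfl⟩⟩
        rw [this, indicator_of_mem (mem_image_of_mem f hx)]
        simp
      · have : {x' ∈ s₁ ∩ t n | f x' = y} = ∅ := by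
          ext x'
          simp only [mem_sep_iff, mem_empty_iff_false, iff_false]
          rintro ⟨h1, rfl⟩
          exact h ⟨x', h1, rfl⟩
        rw [this, indicator_of_notMem h]
        simp
    · intro i j hij
      exact (hdisj hij).mono (fun x hx ↦ hx.1.2) (fun x hx ↦ hx.1.2)
  have hmi : ∀ n, Measurable ((f '' (s₁ ∩ t n)).indicator (1 : F → ℝ≥0∞)) := fun n ↦
    measurable_one.indicator (himg n)
  refine ⟨(Measurable.tsum hmi).aemeasurable.congr hae.symm, ?_⟩
  rw [lintegral_congr_ae hae, lintegral_tsum fun n ↦ (hmi n).aemeasurable]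
  have hsplit : ∫⁻ x in s, ENNReal.ofReal |(fderiv ℝ f x).det| ∂μ =
      ∫⁻ x in s₁, ENNReal.ofReal |(fderiv ℝ f x).det| ∂μ := by
    rw [← lintegral_inter_add_sdiff (μ := μ) _ s
      (hmeas (measurableSet_singleton (0 : ℝ)).compl)]
    have : ∫⁻ x in s \ (fun x ↦ (fderiv ℝ f x).det) ⁻¹' {0}ᶜ,
        ENNReal.ofReal |(fderiv ℝ f x).det| ∂μ = 0 := by
      refine setLIntegral_eq_zero (hs.diff (hmeas (measurableSet_singleton (0 : ℝ)).compl)) ?_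
      intro x hx
      have : (fderiv ℝ f x).det = 0 := by simpa using hx.2
      simp [this]
    rw [this, add_zero]
    rfl
  have hcov' : s₁ = ⋃ n, s₁ ∩ t n := by
    rw [← inter_iUnion, inter_eq_left.2 hcov]
  rw [hsplit]
  conv_rhs => rw [hcov']
  rw [lintegral_iUnion (fun n ↦ hs₁.inter (htm n))
    (fun i j hij ↦ (hdisj hij).mono inter_subset_right inter_subset_right)]
  refine tsum_congr fun n ↦ ?_
  rw [lintegral_indicator_one (himg n),
    lintegral_abs_det_fderiv_eq_addHaar_image μ (hs₁.inter (htm n)) (hder n) (hinj n)]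

end AreaFormula

/-! ### Local orthonormal frames -/

section Frames

open InnerProductSpace

variable {X E : Type*} [NormedAddCommGroup X] [NormedSpace ℝ X]
  [NormedAddCommGroup E] [InnerProductSpace ℝ E]

/-- By strong induction on the index: each new vector is a rational expression in the earlier ones,
and linear independence keeps the denominators away from zero. -/
theorem contDiffOn_gramSchmidt {k : ℕ} {f : Fin k → X → E} {Ω : Set X} {p : ℕ∞ω}
    (hf : ∀ i, ContDiffOn ℝ p (f i) Ω) (hli : ∀ z ∈ Ω, LinearIndependent ℝ fun i ↦ f i z)
    (i : Fin k) : ContDiffOn ℝ p (fun z ↦ gramSchmidt ℝ (fun j ↦ f j z) i) Ω := by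
  induction i using WellFoundedLT.induction with
  | ind i ih =>
    simp_rw [gramSchmidt_def ℝ _ i, Submodule.starProjection_singleton]
    refine (hf i).sub (ContDiffOn.sum fun j hj ↦ ?_)
    have hj' := ih j (Finset.mem_Iio.1 hj)
    refine ContDiffOn.smul (ContDiffOn.div (hj'.inner ℝ (hf i)) ?_ fun z hz ↦ ?_) hj'
    · exact (hj'.norm_sq ℝ)
    · have := gramSchmidt_ne_zero j (hli z hz)
      simpa using this

theorem contDiffOn_gramSchmidtNormed {k : ℕ} {f : Fin k → X → E} {Ω : Set X} {p : ℕ∞ω}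
    (hf : ∀ i, ContDiffOn ℝ p (f i) Ω) (hli : ∀ z ∈ Ω, LinearIndependent ℝ fun i ↦ f i z)
    (i : Fin k) : ContDiffOn ℝ p (fun z ↦ gramSchmidtNormed ℝ (fun j ↦ f j z) i) Ω := by
  have h := contDiffOn_gramSchmidt hf hli i
  have h0 : ∀ z ∈ Ω, gramSchmidt ℝ (fun j ↦ f j z) i ≠ 0 := fun z hz ↦
    gramSchmidt_ne_zero i (hli z hz)
  exact ContDiffOn.smul ((h.norm ℝ h0).inv fun z hz ↦ norm_ne_zero_iff.2 (h0 z hz)) h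

/-- The linear map `ℝ^k → E` with values `u i` at the standard basis. -/
noncomputable def frameMap {k : ℕ} (u : Fin k → E) : EuclideanSpace ℝ (Fin k) →L[ℝ] E :=
  ∑ i, (EuclideanSpace.proj i).smulRight (u i)

theorem frameMap_apply {k : ℕ} (u : Fin k → E) (a : EuclideanSpace ℝ (Fin k)) :
    frameMap u a = ∑ i, a i • u i := by
  simp [frameMap]

theorem norm_frameMap {k : ℕ} {u : Fin k → E} (hu : Orthonormal ℝ u)
    (a : EuclideanSpace ℝ (Fin k)) : ‖frameMap u a‖ = ‖a‖ := by
  have h : ‖frameMap u a‖ ^ 2 = ‖a‖ ^ 2 := by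
    rw [frameMap_apply, ← real_inner_self_eq_norm_sq, hu.inner_sum, EuclideanSpace.norm_sq_eq]
    simp [sq]
  exact (sq_eq_sq₀ (norm_nonneg _) (norm_nonneg _)).1 h

theorem range_frameMap {k : ℕ} (u : Fin k → E) :
    LinearMap.range (frameMap u).toLinearMap = Submodule.span ℝ (range u) := by
  ext v
  rw [Submodule.mem_span_range_iff_exists_fun]
  constructor
  · rintro ⟨a, rfl⟩
    exact ⟨a, (frameMap_apply u a).symm⟩
  · rintro ⟨c, rfl⟩
    exact ⟨WithLp.toLp 2 c, frameMap_apply u _⟩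

theorem contDiffOn_frameMap {k : ℕ} {f : Fin k → X → E} {Ω : Set X} {p : ℕ∞ω}
    (hf : ∀ i, ContDiffOn ℝ p (f i) Ω) : ContDiffOn ℝ p (fun z ↦ frameMap fun i ↦ f i z) Ω := by
  unfold frameMap
  exact ContDiffOn.sum fun i _ ↦ contDiffOn_const.smulRight (hf i)

variable [FiniteDimensional ℝ E]

/-- Gram–Schmidt on the columns of `T` gives `A`. For `B`, a fixed orthonormal basis of the
complement at `z₀` is projected off the range of `T z`; it is unchanged at `z₀`, hence stays
independent on a small ball, and Gram–Schmidt applies again. -/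
theorem exists_orthonormal_frames {m n : ℕ}
    {T : X → EuclideanSpace ℝ (Fin m) →L[ℝ] E} {Ω : Set X} (hΩ : IsOpen Ω)
    (hT : ContDiffOn ℝ 1 T Ω) (hinj : ∀ z ∈ Ω, Function.Injective (T z)) {z₀ : X} (hz₀ : z₀ ∈ Ω)
    (hn : Module.finrank ℝ E = m + n) :
    ∃ r > 0, ball z₀ r ⊆ Ω ∧ ∃ (A : X → EuclideanSpace ℝ (Fin m) →L[ℝ] E)
      (B : X → EuclideanSpace ℝ (Fin n) →L[ℝ] E), ContDiffOn ℝ 1 A (ball z₀ r) ∧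
      ContDiffOn ℝ 1 B (ball z₀ r) ∧ ∀ z ∈ ball z₀ r, (∀ a, ‖A z a‖ = ‖a‖) ∧
        (∀ c, ‖B z c‖ = ‖c‖) ∧ (∀ a c, ⟪A z a, B z c⟫_ℝ = 0) ∧
        LinearMap.range (A z).toLinearMap = LinearMap.range (T z).toLinearMap := by
  classical
  let f : Fin m → X → E := fun i z ↦ T z (EuclideanSpace.single i 1)
  have hf : ∀ i, ContDiffOn ℝ 1 (f i) Ω := fun i ↦ hT.clm_apply contDiffOn_const
  have hli : ∀ z ∈ Ω, LinearIndependent ℝ fun i ↦ f i z := fun z hz ↦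
    (EuclideanSpace.basisFun (Fin m) ℝ).toBasis.linearIndependent.map' (T z).toLinearMap
      (LinearMap.ker_eq_bot.2 (hinj z hz)) |> fun h ↦ by
        convert! h using 1
        ext i
        simp [f]
  let u : Fin m → X → E := fun i z ↦ gramSchmidtNormed ℝ (fun j ↦ f j z) i
  have hu : ∀ i, ContDiffOn ℝ 1 (u i) Ω := contDiffOn_gramSchmidtNormed hf hli
  have huo : ∀ z ∈ Ω, Orthonormal ℝ fun i ↦ u i z := fun z hz ↦
    gramSchmidtNormed_orthonormal (hli z hz)
  have hrange : ∀ z, LinearMap.range (frameMap fun i ↦ u i z).toLinearMap =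
      LinearMap.range (T z).toLinearMap := by
    intro z
    rw [range_frameMap]
    change Submodule.span ℝ (range (gramSchmidtNormed ℝ fun j ↦ f j z)) = _
    rw [span_gramSchmidtNormed_range, span_gramSchmidt,
      ← Submodule.map_top (T z).toLinearMap,
      ← (EuclideanSpace.basisFun (Fin m) ℝ).toBasis.span_eq, Submodule.map_span, ← range_comp]
    congr 2
    ext i
    simp [f]
  let K₀ : Submodule ℝ E := (LinearMap.range (T z₀).toLinearMap)ᗮ
  have hK₀ : Module.finrank ℝ K₀ = n := by
    have h1 := (LinearMap.range (T z₀).toLinearMap).finrank_add_finrank_orthogonal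
    rw [LinearMap.finrank_range_of_inj (hinj z₀ hz₀), finrank_euclideanSpace_fin] at h1
    change m + Module.finrank ℝ K₀ = _ at h1
    omega
  let κ₀ : OrthonormalBasis (Fin n) ℝ K₀ := (stdOrthonormalBasis ℝ K₀).reindex (finCongr hK₀)
  let g : Fin n → X → E := fun k z ↦ (κ₀ k : E) - ∑ i, ⟪u i z, (κ₀ k : E)⟫_ℝ • u i z
  have hg : ∀ k, ContDiffOn ℝ 1 (g k) Ω := fun k ↦
    contDiffOn_const.sub (ContDiffOn.sum fun i _ ↦ ((hu i).inner ℝ contDiffOn_const).smul (hu i))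
  have hg₀ : (fun k ↦ g k z₀) = fun k ↦ (κ₀ k : E) := by
    ext k
    have : ∀ i, ⟪u i z₀, (κ₀ k : E)⟫_ℝ = 0 := fun i ↦ by
      refine (Submodule.mem_orthogonal _ _).1 (κ₀ k).2 _ ?_
      rw [← hrange z₀, range_frameMap]
      exact Submodule.subset_span ⟨i, rfl⟩
    simp [g, this]
  have hev : ∀ᶠ z in nhds z₀, LinearIndependent ℝ fun k ↦ g k z := by
    have hc : ContinuousAt (fun z k ↦ g k z) z₀ := continuousAt_pi.2 fun k ↦
      (hg k).continuousOn.continuousAt (hΩ.mem_nhds hz₀)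
    refine hc.eventually (LinearIndependent.eventually ?_)
    change LinearIndependent ℝ fun k ↦ g k z₀
    rw [hg₀]
    exact κ₀.toBasis.linearIndependent.map' K₀.subtype K₀.ker_subtype |> fun h ↦ by
      convert! h using 1
  obtain ⟨r, hr, hball⟩ := Metric.mem_nhds_iff.1 (Filter.inter_mem (hΩ.mem_nhds hz₀) hev)
  have hbΩ : ball z₀ r ⊆ Ω := fun z hz ↦ (hball hz).1
  let κ : Fin n → X → E := fun k z ↦ gramSchmidtNormed ℝ (fun j ↦ g j z) k
  refine ⟨r, hr, hbΩ, fun z ↦ frameMap fun i ↦ u i z, fun z ↦ frameMap fun k ↦ κ k z,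
    contDiffOn_frameMap fun i ↦ (hu i).mono hbΩ,
    contDiffOn_frameMap (contDiffOn_gramSchmidtNormed (fun k ↦ (hg k).mono hbΩ)
      fun z hz ↦ (hball hz).2), fun z hz ↦ ⟨norm_frameMap (huo z (hbΩ hz)),
    norm_frameMap (gramSchmidtNormed_orthonormal (hball hz).2), fun a c ↦ ?_, hrange z⟩⟩
  have hug : ∀ i k, ⟪u i z, g k z⟫_ℝ = 0 := by
    intro i k
    have := (huo z (hbΩ hz)).inner_right_fintype (fun i ↦ ⟪u i z, (κ₀ k : E)⟫_ℝ) i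
    simp only [g, inner_sub_right, this, sub_self]
  have hle : LinearMap.range (frameMap fun k ↦ κ k z).toLinearMap ≤
      (LinearMap.range (frameMap fun i ↦ u i z).toLinearMap)ᗮ := by
    rw [range_frameMap, range_frameMap]
    change Submodule.span ℝ (range (gramSchmidtNormed ℝ fun j ↦ g j z)) ≤ _
    rw [span_gramSchmidtNormed_range, span_gramSchmidt]
    refine (Submodule.isOrtho_span.2 ?_).symm
    rintro _ ⟨i, rfl⟩ _ ⟨k, rfl⟩
    exact hug i k
  exact (Submodule.mem_orthogonal _ _).1 (hle ⟨c, rfl⟩) _ ⟨a, rfl⟩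

end Frames

/-! ### The incidence formula in Euclidean space -/

section Incidence

/-- The unit ball and its preimage have the same finite positive measure, while their ratio is `|det
Q⁻¹|`. -/
theorem abs_det_eq_one_of_measurePreserving {F : Type*} [NormedAddCommGroup F] [NormedSpace ℝ F]
    [FiniteDimensional ℝ F] [MeasurableSpace F] [BorelSpace F] (μ : Measure F)
    [μ.IsAddHaarMeasure] (Q : F ≃L[ℝ] F) (hQ : MeasurePreserving Q μ μ) :
    |(Q : F →L[ℝ] F).det| = 1 := by
  have h1 := μ.addHaar_preimage_continuousLinearEquiv Q (ball 0 1)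
  rw [hQ.measure_preimage measurableSet_ball.nullMeasurableSet] at h1
  have h2 : ENNReal.ofReal |LinearMap.det (Q.symm : F →ₗ[ℝ] F)| = 1 := by
    have := ENNReal.mul_left_inj (c := μ (ball 0 1)) (measure_ball_pos μ 0 one_pos).ne'
      measure_ball_lt_top.ne |>.1 ((one_mul _).trans h1)
    exact this.symm
  have h3 : |LinearMap.det (Q.symm : F →ₗ[ℝ] F)| = 1 := by
    rwa [ENNReal.ofReal_eq_one] at h2
  have h4 : LinearMap.det (Q.symm : F →ₗ[ℝ] F) * LinearMap.det (Q : F →ₗ[ℝ] F) = 1 := by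
    rw [← LinearMap.det_comp]
    convert! LinearMap.det_id (A := ℝ) (M := F)
    ext x
    simp
  have h5 := congrArg (fun t : ℝ ↦ |t|) h4
  simp only [abs_mul, h3, one_mul, abs_one] at h5
  exact h5

/-- The determinant of a block triangular map whose second diagonal block is the identity. -/
theorem det_prod_unipotent {U W : Type*} [AddCommGroup U] [Module ℝ U] [Module.Finite ℝ U]
    [AddCommGroup W] [Module ℝ W] [Module.Finite ℝ W] (S : U →ₗ[ℝ] U) (R : U →ₗ[ℝ] W) :
    LinearMap.det ((S ∘ₗ LinearMap.fst ℝ U W).prod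
      (R ∘ₗ LinearMap.fst ℝ U W + LinearMap.snd ℝ U W)) = LinearMap.det S := by
  classical
  let b := Module.finBasis ℝ U
  let c := Module.finBasis ℝ W
  rw [← LinearMap.det_toMatrix (b.prod c)]
  have : LinearMap.toMatrix (b.prod c) (b.prod c) ((S ∘ₗ LinearMap.fst ℝ U W).prod
      (R ∘ₗ LinearMap.fst ℝ U W + LinearMap.snd ℝ U W)) =
      Matrix.fromBlocks (LinearMap.toMatrix b b S) 0 (LinearMap.toMatrix b c R) 1 := by
    ext i j
    rcases i with i | i <;> rcases j with j | j <;>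
      simp [LinearMap.toMatrix_apply, Matrix.one_apply, Finsupp.single_apply, eq_comm]
  rw [this, Matrix.det_fromBlocks_zero₁₂, Matrix.det_one, mul_one, LinearMap.det_toMatrix]

variable {E : Type*} [NormedAddCommGroup E] [InnerProductSpace ℝ E]

section

variable [FiniteDimensional ℝ E] [MeasurableSpace E] [BorelSpace E]
  {U W : Type*} [NormedAddCommGroup U] [InnerProductSpace ℝ U] [FiniteDimensional ℝ U]
  [MeasurableSpace U] [BorelSpace U] [NormedAddCommGroup W] [InnerProductSpace ℝ W]
  [FiniteDimensional ℝ W] [MeasurableSpace W] [BorelSpace W]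

/-- The product `U × W` has the sup norm, so the isometry must start from `WithLp 2`; the two
structures have the same Lebesgue measure. -/
theorem LinearIsometryEquiv.measurePreserving_comp_toLp (L : WithLp 2 (U × W) ≃ₗᵢ[ℝ] E) :
    MeasurePreserving
      ((WithLp.prodContinuousLinearEquiv 2 ℝ U W).symm.trans L.toContinuousLinearEquiv) :=
  L.measurePreserving.comp (WithLp.volume_preserving_toLp U W)

instance isAddHaarMeasure_volume_prod : (volume : Measure (U × W)).IsAddHaarMeasure := by
  rw [Measure.volume_eq_prod]
  infer_instance

/-- Identifies the target of `(z, c) ↦ B z c` with its source, so that the area formula for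
self-maps applies. -/
theorem exists_measurePreserving_equiv_of_finrank_eq
    (h : Module.finrank ℝ E = Module.finrank ℝ U + Module.finrank ℝ W) :
    ∃ L : (U × W) ≃L[ℝ] E, MeasurePreserving L := by
  have h' : Module.finrank ℝ (WithLp 2 (U × W)) = Module.finrank ℝ E := by
    rw [h, ← Module.finrank_prod]
    exact (WithLp.prodContinuousLinearEquiv 2 ℝ U W).toLinearEquiv.finrank_eq
  exact ⟨_, ((stdOrthonormalBasis ℝ (WithLp 2 (U × W))).equiv (stdOrthonormalBasis ℝ E)
    (finCongr h')).measurePreserving_comp_toLp⟩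

/-- By Pythagoras `a + b` is isometric on the Euclidean product, and equality of dimensions makes it
onto. -/
theorem exists_measurePreserving_equiv_of_isometry
    (h : Module.finrank ℝ E = Module.finrank ℝ U + Module.finrank ℝ W) {a : U →L[ℝ] E}
    {b : W →L[ℝ] E} (ha : ∀ x, ‖a x‖ = ‖x‖) (hb : ∀ y, ‖b y‖ = ‖y‖)
    (hab : ∀ x y, ⟪a x, b y⟫_ℝ = 0) :
    ∃ L : (U × W) ≃L[ℝ] E, MeasurePreserving L ∧ ∀ p, L p = a p.1 + b p.2 := by
  have h' : Module.finrank ℝ (WithLp 2 (U × W)) = Module.finrank ℝ E := by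
    rw [h, ← Module.finrank_prod]
    exact (WithLp.prodContinuousLinearEquiv 2 ℝ U W).toLinearEquiv.finrank_eq
  let i : WithLp 2 (U × W) →ₗᵢ[ℝ] E :=
    { toLinearMap := (a.coprod b).toLinearMap ∘ₗ
        (WithLp.prodContinuousLinearEquiv 2 ℝ U W).toLinearEquiv.toLinearMap
      norm_map' := fun p ↦ by
        have h1 : ‖a p.fst + b p.snd‖ ^ 2 = ‖p‖ ^ 2 := by
          -- The cross term vanishes by `hab`.
          rw [norm_add_sq_real, hab, ha, hb, WithLp.prod_norm_sq_eq_of_L2]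
          ring
        exact (sq_eq_sq₀ (norm_nonneg _) (norm_nonneg _)).1 h1 }
  refine ⟨_, (i.toLinearIsometryEquiv h').measurePreserving_comp_toLp, fun p ↦ rfl⟩

end

variable {m n : ℕ}

/-- The matrix of the second fundamental form `⟨D_i (A e_j), v⟩` of the bundle spanned by a frame
`A`. -/
noncomputable def frameMatrix {k : ℕ}
    (A : EuclideanSpace ℝ (Fin m) → EuclideanSpace ℝ (Fin k) →L[ℝ] E)
    (z : EuclideanSpace ℝ (Fin m)) (v : E) : Matrix (Fin m) (Fin k) ℝ :=
  Matrix.of fun i j ↦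
    ⟪fderiv ℝ A z (EuclideanSpace.single i 1) (EuclideanSpace.single j 1), v⟫_ℝ

/-- A pair of complementary orthonormal frames over a set `Ω`. -/
structure IsFramePair (A : EuclideanSpace ℝ (Fin m) → EuclideanSpace ℝ (Fin m) →L[ℝ] E)
    (B : EuclideanSpace ℝ (Fin m) → EuclideanSpace ℝ (Fin n) →L[ℝ] E)
    (Ω : Set (EuclideanSpace ℝ (Fin m))) : Prop where
  isOpen : IsOpen Ω
  finrank_eq : Module.finrank ℝ E = m + n
  contDiffOn_left : ContDiffOn ℝ 1 A Ω
  contDiffOn_right : ContDiffOn ℝ 1 B Ω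
  norm_left : ∀ z ∈ Ω, ∀ a, ‖A z a‖ = ‖a‖
  norm_right : ∀ z ∈ Ω, ∀ c, ‖B z c‖ = ‖c‖
  inner_eq_zero : ∀ z ∈ Ω, ∀ a c, ⟪A z a, B z c⟫_ℝ = 0

namespace IsFramePair

variable {A : EuclideanSpace ℝ (Fin m) → EuclideanSpace ℝ (Fin m) →L[ℝ] E}
  {B : EuclideanSpace ℝ (Fin m) → EuclideanSpace ℝ (Fin n) →L[ℝ] E}
  {Ω : Set (EuclideanSpace ℝ (Fin m))}

theorem differentiableAt_left (h : IsFramePair A B Ω) {z : EuclideanSpace ℝ (Fin m)}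
    (hz : z ∈ Ω) : DifferentiableAt ℝ A z :=
  (h.contDiffOn_left.contDiffAt (h.isOpen.mem_nhds hz)).differentiableAt one_ne_zero

theorem differentiableAt_right (h : IsFramePair A B Ω) {z : EuclideanSpace ℝ (Fin m)}
    (hz : z ∈ Ω) : DifferentiableAt ℝ B z :=
  (h.contDiffOn_right.contDiffAt (h.isOpen.mem_nhds hz)).differentiableAt one_ne_zero

/-- The derivative of the vanishing function `⟪A a, B c⟫`. It expresses the motion of `K` through
the shape operator of `K^⊥`. -/
theorem inner_fderiv_right (h : IsFramePair A B Ω) {z : EuclideanSpace ℝ (Fin m)} (hz : z ∈ Ω)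
    (x a : EuclideanSpace ℝ (Fin m)) (c : EuclideanSpace ℝ (Fin n)) :
    ⟪A z a, fderiv ℝ B z x c⟫_ℝ = -⟪fderiv ℝ A z x a, B z c⟫_ℝ := by
  have hA : HasFDerivAt (fun y ↦ A y a) ((fderiv ℝ A z).flip a) z := by
    simpa using (h.differentiableAt_left hz).hasFDerivAt.clm_apply (hasFDerivAt_const a z)
  have hB : HasFDerivAt (fun y ↦ B y c) ((fderiv ℝ B z).flip c) z := by
    simpa using (h.differentiableAt_right hz).hasFDerivAt.clm_apply (hasFDerivAt_const c z)
  have h1 := hA.inner ℝ hB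
  have h2 : (fun y ↦ ⟪A y a, B y c⟫_ℝ) =ᶠ[nhds z] fun _ ↦ 0 := by
    filter_upwards [h.isOpen.mem_nhds hz] with y hy using h.inner_eq_zero y hy a c
  have h3 := h1.unique ((hasFDerivAt_const (0 : ℝ) z).congr_of_eventuallyEq h2)
  have h4 := DFunLike.congr_fun h3 x
  simp only [ContinuousLinearMap.comp_apply, ContinuousLinearMap.prod_apply, fderivInnerCLM_apply,
    ContinuousLinearMap.flip_apply, zero_apply] at h4
  linarith

theorem continuousOn_det_frameMatrix (h : IsFramePair A B Ω) :
    ContinuousOn (fun p : EuclideanSpace ℝ (Fin m) × EuclideanSpace ℝ (Fin n) ↦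
      (frameMatrix A p.1 (B p.1 p.2)).det) (Ω ×ˢ univ) := by
  have h1 : ContinuousOn (fun p : EuclideanSpace ℝ (Fin m) × EuclideanSpace ℝ (Fin n) ↦
      fderiv ℝ A p.1) (Ω ×ˢ univ) :=
    (h.contDiffOn_left.continuousOn_fderiv_of_isOpen h.isOpen le_rfl).comp continuousOn_fst
      fun p hp ↦ hp.1
  have h2 : ContinuousOn (fun p : EuclideanSpace ℝ (Fin m) × EuclideanSpace ℝ (Fin n) ↦
      B p.1 p.2) (Ω ×ˢ univ) :=
    (h.contDiffOn_right.continuousOn.comp continuousOn_fst fun p hp ↦ hp.1).clm_apply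
      continuousOn_snd
  have h3 : ContinuousOn (fun p : EuclideanSpace ℝ (Fin m) × EuclideanSpace ℝ (Fin n) ↦
      frameMatrix A p.1 (B p.1 p.2)) (Ω ×ˢ univ) := by
    refine continuousOn_pi.2 fun i ↦ continuousOn_pi.2 fun j ↦ ?_
    exact ((h1.clm_apply continuousOn_const).clm_apply continuousOn_const).inner h2
  exact (Continuous.matrix_det continuous_id).comp_continuousOn h3

/-- The determinant is continuous, hence bounded on the product of `C` with the closed unit ball.
This is the source of the finiteness of the expected number. -/
theorem lintegral_lt_top (h : IsFramePair A B Ω) {C : Set (EuclideanSpace ℝ (Fin m))}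
    (hC : IsCompact C) (hCΩ : C ⊆ Ω) :
    ∫⁻ z in C, ∫⁻ c in ball 0 1 \ {0}, ENNReal.ofReal |(frameMatrix A z (B z c)).det| < ⊤ := by
  obtain ⟨M, hM⟩ := (hC.prod (isCompact_closedBall (0 : EuclideanSpace ℝ (Fin n)) 1)).bddAbove_image
    (h.continuousOn_det_frameMatrix.abs.mono (prod_mono hCΩ (subset_univ _)))
  have hle : ∀ z ∈ C, ∫⁻ c in ball 0 1 \ {0}, ENNReal.ofReal |(frameMatrix A z (B z c)).det| ≤
      ENNReal.ofReal M * volume (ball (0 : EuclideanSpace ℝ (Fin n)) 1) := by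
    intro z hz
    calc ∫⁻ c in ball 0 1 \ {0}, ENNReal.ofReal |(frameMatrix A z (B z c)).det|
        ≤ ∫⁻ c in ball (0 : EuclideanSpace ℝ (Fin n)) 1 \ {0}, ENNReal.ofReal M := by
          refine setLIntegral_mono measurable_const fun c hc ↦ ENNReal.ofReal_le_ofReal ?_
          exact hM ⟨(z, c), ⟨hz, ball_subset_closedBall hc.1⟩, rfl⟩
      _ ≤ _ := by
          rw [setLIntegral_const]
          gcongr
          exact sdiff_subset
  calc _ ≤ ∫⁻ z in C, ENNReal.ofReal M * volume (ball (0 : EuclideanSpace ℝ (Fin n)) 1) :=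
        setLIntegral_mono measurable_const hle
    _ < ⊤ := by
        rw [setLIntegral_const]
        exact ENNReal.mul_lt_top (ENNReal.mul_lt_top ENNReal.ofReal_lt_top measure_ball_lt_top)
          hC.measure_lt_top

/-- The inner integral of the incidence formula depends measurably on the base point. -/
theorem aemeasurable_lintegral (h : IsFramePair A B Ω) {s : Set (EuclideanSpace ℝ (Fin m))}
    (hs : MeasurableSet s) (hsΩ : s ⊆ Ω) :
    AEMeasurable (fun z ↦ ∫⁻ c in ball 0 1 \ {0},
      ENNReal.ofReal |(frameMatrix A z (B z c)).det|) (volume.restrict s) := by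
  have h1 : AEMeasurable (fun p : EuclideanSpace ℝ (Fin m) × EuclideanSpace ℝ (Fin n) ↦
      ENNReal.ofReal |(frameMatrix A p.1 (B p.1 p.2)).det|)
      ((volume.restrict s).prod (volume.restrict (ball 0 1 \ {0}))) := by
    rw [Measure.prod_restrict]
    refine ENNReal.measurable_ofReal.comp_aemeasurable (ContinuousOn.aemeasurable ?_
      (hs.prod (measurableSet_ball.diff (measurableSet_singleton _))))
    exact h.continuousOn_det_frameMatrix.abs.mono (prod_mono hsΩ (subset_univ _))
  exact h1.lintegral_prod_right'

variable [FiniteDimensional ℝ E] [MeasurableSpace E] [BorelSpace E]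

/-- The Jacobian of the parametrization `(z, c) ↦ B z c` of the orthogonal bundle. -/
theorem abs_det_fderiv (h : IsFramePair A B Ω)
    (L : (EuclideanSpace ℝ (Fin m) × EuclideanSpace ℝ (Fin n)) ≃L[ℝ] E)
    (hL : MeasurePreserving L) {z : EuclideanSpace ℝ (Fin m)} (hz : z ∈ Ω)
    (c : EuclideanSpace ℝ (Fin n)) :
    DifferentiableAt ℝ (fun p : EuclideanSpace ℝ (Fin m) × EuclideanSpace ℝ (Fin n) ↦
      L.symm (B p.1 p.2)) (z, c) ∧
    |(fderiv ℝ (fun p : EuclideanSpace ℝ (Fin m) × EuclideanSpace ℝ (Fin n) ↦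
      L.symm (B p.1 p.2)) (z, c)).det| = |(frameMatrix A z (B z c)).det| := by
  -- The moving frame `A z ⊕ B z` preserves volume, so it may replace the fixed identification `L`
  -- at the cost of a factor `Q` of determinant `±1`.
  obtain ⟨Lz, hLz, hLza⟩ := exists_measurePreserving_equiv_of_isometry
    (by simpa using h.finrank_eq) (h.norm_left z hz) (h.norm_right z hz) (h.inner_eq_zero z hz)
  set Q : (EuclideanSpace ℝ (Fin m) × EuclideanSpace ℝ (Fin n)) ≃L[ℝ]
    (EuclideanSpace ℝ (Fin m) × EuclideanSpace ℝ (Fin n)) := Lz.trans L.symm with hQ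
  have hQm : MeasurePreserving Q := by
    have h1 : MeasurePreserving L.symm :=
      MeasurePreserving.symm L.toHomeomorph.toMeasurableEquiv hL
    exact h1.comp hLz
  set DB : EuclideanSpace ℝ (Fin m) →L[ℝ] E := (fderiv ℝ B z).flip c with hDB
  let S : EuclideanSpace ℝ (Fin m) →L[ℝ] EuclideanSpace ℝ (Fin m) :=
    ContinuousLinearMap.fst ℝ _ _ ∘L Lz.symm.toContinuousLinearMap ∘L DB
  let R : EuclideanSpace ℝ (Fin m) →L[ℝ] EuclideanSpace ℝ (Fin n) :=
    ContinuousLinearMap.snd ℝ _ _ ∘L Lz.symm.toContinuousLinearMap ∘L DB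
  -- The derivative read in the moving frame. It is block triangular with second diagonal block the
  -- identity, because the derivative in `c` is `B z` itself.
  let D : (EuclideanSpace ℝ (Fin m) × EuclideanSpace ℝ (Fin n)) →L[ℝ]
      (EuclideanSpace ℝ (Fin m) × EuclideanSpace ℝ (Fin n)) :=
    (S ∘L ContinuousLinearMap.fst ℝ _ _).prod
      (R ∘L ContinuousLinearMap.fst ℝ _ _ + ContinuousLinearMap.snd ℝ _ _)
  have hD : HasFDerivAt (fun p : EuclideanSpace ℝ (Fin m) × EuclideanSpace ℝ (Fin n) ↦
      L.symm (B p.1 p.2)) (Q.toContinuousLinearMap ∘L D) (z, c) := by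
    have hB1 : HasFDerivAt (fun p : EuclideanSpace ℝ (Fin m) × EuclideanSpace ℝ (Fin n) ↦ B p.1)
        ((fderiv ℝ B z) ∘L ContinuousLinearMap.fst ℝ _ _) (z, c) :=
      HasFDerivAt.comp (f := Prod.fst) (g := B) (z, c) (h.differentiableAt_right hz).hasFDerivAt
        hasFDerivAt_fst
    have h1 := hB1.clm_apply (hasFDerivAt_snd (p := (z, c)) (𝕜 := ℝ))
    have h2 := L.symm.toContinuousLinearMap.hasFDerivAt.comp (z, c) h1
    refine h2.congr_fderiv ?_
    refine ContinuousLinearMap.ext fun p ↦ ?_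
    have h3 : B z p.2 = Lz (0, p.2) := by simp [hLza]
    have h4 : Lz.symm (DB p.1 + B z p.2) = D p := by
      rw [map_add, h3, Lz.symm_apply_apply]
      ext1 <;> simp [D, S, R]
    have h5 : Q.toContinuousLinearMap (D p) = L.symm (DB p.1 + B z p.2) := by
      rw [← h4]
      simp [hQ]
    rw [ContinuousLinearMap.comp_apply, ContinuousLinearMap.comp_apply, h5]
    simp [hDB, add_comm]
  refine ⟨hD.differentiableAt, ?_⟩
  rw [hD.fderiv]
  have hdet : (Q.toContinuousLinearMap ∘L D).det =
      Q.toContinuousLinearMap.det * D.det :=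
    LinearMap.det_comp _ _
  have hDS : D.det = S.det := det_prod_unipotent S.toLinearMap R.toLinearMap
  rw [hdet, abs_mul, abs_det_eq_one_of_measurePreserving volume Q hQm, one_mul, hDS]
  -- The block `S` is the `A`-component of the derivative of `B · c`, so its entries are inner
  -- products with the vectors `A z e_j`.
  have hS : ∀ x j, S x j = -⟪fderiv ℝ A z x (EuclideanSpace.single j 1), B z c⟫_ℝ := by
    intro x j
    rw [← h.inner_fderiv_right hz]
    change _ = ⟪A z (EuclideanSpace.single j 1), DB x⟫_ℝ
    have h1 : DB x = A z (S x) + B z (R x) := by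
      have := hLza (Lz.symm (DB x))
      rwa [Lz.apply_symm_apply] at this
    have h2 : ∀ a b, ⟪A z a, A z b⟫_ℝ = ⟪a, b⟫_ℝ :=
      LinearIsometry.inner_map_map ⟨(A z).toLinearMap, h.norm_left z hz⟩
    rw [h1, inner_add_right, h.inner_eq_zero z hz, add_zero, h2]
    simp [EuclideanSpace.inner_single_left]
  have hSM : LinearMap.toMatrix (EuclideanSpace.basisFun (Fin m) ℝ).toBasis
      (EuclideanSpace.basisFun (Fin m) ℝ).toBasis S.toLinearMap =
      -(frameMatrix A z (B z c)).transpose := by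
    ext j i
    simp [LinearMap.toMatrix_apply, frameMatrix, hS]
  change |LinearMap.det S.toLinearMap| = _
  rw [← LinearMap.det_toMatrix (EuclideanSpace.basisFun (Fin m) ℝ).toBasis, hSM, Matrix.det_neg,
    Matrix.det_transpose, abs_mul, abs_pow, abs_neg, abs_one, one_pow, one_mul]

/-- The incidence formula: counting the base points `z` with `v ∈ range (B z)` amounts to
integrating the Jacobian over the total space of the bundle `z ↦ range (B z)`. -/
theorem lintegral_encard (h : IsFramePair A B Ω) {s : Set (EuclideanSpace ℝ (Fin m))}
    (hs : MeasurableSet s) (hsΩ : s ⊆ Ω) :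
    AEMeasurable (fun v ↦ ({z ∈ s | v ∈ range (B z)}.encard : ℝ≥0∞))
      ((volume : Measure E).restrict (ball 0 1 \ {0})) ∧
    ∫⁻ v in ball (0 : E) 1 \ {0}, ({z ∈ s | v ∈ range (B z)}.encard : ℝ≥0∞) =
      ∫⁻ z in s, ∫⁻ c in ball 0 1 \ {0}, ENNReal.ofReal |(frameMatrix A z (B z c)).det| := by
  obtain ⟨L, hL⟩ := exists_measurePreserving_equiv_of_finrank_eq (E := E)
    (U := EuclideanSpace ℝ (Fin m)) (W := EuclideanSpace ℝ (Fin n)) (by simpa using h.finrank_eq)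
  have hLs : MeasurePreserving L.symm := MeasurePreserving.symm L.toHomeomorph.toMeasurableEquiv hL
  set f : EuclideanSpace ℝ (Fin m) × EuclideanSpace ℝ (Fin n) →
    EuclideanSpace ℝ (Fin m) × EuclideanSpace ℝ (Fin n) := fun p ↦ L.symm (B p.1 p.2) with hf
  have hb : MeasurableSet (ball (0 : EuclideanSpace ℝ (Fin n)) 1 \ {0}) :=
    measurableSet_ball.diff (measurableSet_singleton _)
  have hbE : MeasurableSet (ball (0 : E) 1 \ {0}) :=
    measurableSet_ball.diff (measurableSet_singleton _)
  obtain ⟨h1, h2⟩ := lintegral_encard_fiber volume (f := f) (hs.prod hb)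
    fun p hp ↦ (h.abs_det_fderiv L hL (hsΩ hp.1) p.2).1
  -- Since `B z` is isometric, a base point `z` determines `c`, and `c` lies in the punctured ball
  -- exactly when `B z c` does. Hence the fibre projects bijectively onto the base points.
  have hcount : ∀ v : E, (({p ∈ s ×ˢ (ball (0 : EuclideanSpace ℝ (Fin n)) 1 \ {0}) |
      f p = L.symm v}.encard : ℕ∞) : ℝ≥0∞) = (ball (0 : E) 1 \ {0}).indicator
        (fun v ↦ ({z ∈ s | v ∈ range (B z)}.encard : ℝ≥0∞)) v := by
    intro v
    have hfp : ∀ p, f p = L.symm v ↔ B p.1 p.2 = v := fun p ↦ L.symm.injective.eq_iff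
    have hnz : ∀ z ∈ s, ∀ c, c ∈ ball (0 : EuclideanSpace ℝ (Fin n)) 1 \ {0} ↔
        B z c ∈ ball (0 : E) 1 \ {0} := by
      intro z hz c
      simp only [mem_sdiff, mem_ball_zero_iff, mem_singleton_iff, h.norm_right z (hsΩ hz),
        ← norm_eq_zero (a := B z c), ← norm_eq_zero (a := c)]
    by_cases hv : v ∈ ball (0 : E) 1 \ {0}
    · rw [indicator_of_mem hv]
      have himg : Prod.fst '' {p ∈ s ×ˢ (ball (0 : EuclideanSpace ℝ (Fin n)) 1 \ {0}) |
          f p = L.symm v} = {z ∈ s | v ∈ range (B z)} := by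
        ext z
        constructor
        · rintro ⟨p, ⟨hp, hpv⟩, rfl⟩
          exact ⟨hp.1, p.2, (hfp p).1 hpv⟩
        · rintro ⟨hz, c, hc⟩
          exact ⟨(z, c), ⟨⟨hz, (hnz z hz c).2 (hc ▸ hv)⟩, (hfp (z, c)).2 hc⟩, rfl⟩
      rw [← himg, InjOn.encard_image]
      rintro ⟨z, c⟩ ⟨hp, hpv⟩ ⟨z', c'⟩ ⟨-, hpv'⟩ hzz
      obtain rfl : z = z' := hzz
      have h3 : B z (c - c') = 0 := by
        rw [map_sub, (hfp (z, c)).1 hpv, (hfp (z, c')).1 hpv', sub_self]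
      have h4 : ‖c - c'‖ = 0 := by rw [← h.norm_right z (hsΩ hp.1), h3, norm_zero]
      rw [norm_eq_zero, sub_eq_zero] at h4
      rw [h4]
    · rw [indicator_of_notMem hv]
      have : {p ∈ s ×ˢ (ball (0 : EuclideanSpace ℝ (Fin n)) 1 \ {0}) | f p = L.symm v} = ∅ := by
        ext p
        simp only [mem_sep_iff, mem_empty_iff_false, iff_false]
        rintro ⟨hp, hpv⟩
        exact hv ((hfp p).1 hpv ▸ (hnz p.1 hp.1 p.2).1 hp.2)
      rw [this]
      simp
  have hcount' : (fun y ↦ ({p ∈ s ×ˢ (ball (0 : EuclideanSpace ℝ (Fin n)) 1 \ {0}) |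
      f p = y}.encard : ℝ≥0∞)) ∘ L.symm = (ball (0 : E) 1 \ {0}).indicator
        (fun v ↦ ({z ∈ s | v ∈ range (B z)}.encard : ℝ≥0∞)) := funext hcount
  constructor
  · rw [← aemeasurable_indicator_iff hbE, ← hcount']
    exact h1.comp_quasiMeasurePreserving hLs.quasiMeasurePreserving
  · rw [← lintegral_indicator hbE, ← hcount']
    refine (hLs.lintegral_comp_emb L.symm.toHomeomorph.measurableEmbedding
      fun y ↦ ({p ∈ s ×ˢ (ball (0 : EuclideanSpace ℝ (Fin n)) 1 \ {0}) |
        f p = y}.encard : ℝ≥0∞)).trans ?_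
    rw [h2, Measure.volume_eq_prod, ← Measure.prod_restrict, lintegral_prod]
    · refine setLIntegral_congr_fun hs fun z hz ↦ lintegral_congr fun c ↦ ?_
      rw [(h.abs_det_fderiv L hL (hsΩ hz) c).2]
    · exact (ENNReal.measurable_ofReal.comp (continuous_abs.measurable.comp
        (ContinuousLinearMap.continuous_det.measurable.comp
          (measurable_fderiv ℝ f)))).aemeasurable

end IsFramePair

end Incidence

/-! ### Integration of homogeneous functions in polar coordinates -/

section Polar

/-- The factor `r ^ k` turns the density `r ^ n` into `r ^ (n + k)`, whose integral over `(0, 1)` is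
`1 / (n + k + 1)`. -/
theorem lintegral_Iio_one_volumeIoiPow (n k : ℕ) :
    ∫⁻ r in Iio ⟨1, mem_Ioi.2 one_pos⟩, ENNReal.ofReal ((r : ℝ) ^ k) ∂Measure.volumeIoiPow n =
      ((n + k + 1 : ℕ) : ℝ≥0∞)⁻¹ := by
  have h1 : Measure.volumeIoiPow (n + k) (Iio ⟨1, mem_Ioi.2 one_pos⟩) =
      ((n + k + 1 : ℕ) : ℝ≥0∞)⁻¹ := by
    rw [Measure.volumeIoiPow_apply_Iio, one_pow, one_div,
      ENNReal.ofReal_inv_of_pos (by positivity)]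
    congr 1
    exact_mod_cast ENNReal.ofReal_natCast (n + k + 1)
  rw [← h1, Measure.volumeIoiPow, Measure.volumeIoiPow, withDensity_apply _ measurableSet_Iio,
    restrict_withDensity measurableSet_Iio, lintegral_withDensity_eq_lintegral_mul]
  · refine lintegral_congr fun r ↦ ?_
    rw [Pi.mul_apply, ← ENNReal.ofReal_mul (pow_nonneg r.2.le _), pow_add]
  · fun_prop
  · fun_prop

variable {F : Type*} [NormedAddCommGroup F] [NormedSpace ℝ F] [FiniteDimensional ℝ F]
  [MeasurableSpace F] [BorelSpace F] (μ : Measure F) [μ.IsAddHaarMeasure]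

/-- In polar coordinates the measure is the product of the sphere measure with `r ^ (d - 1) dr` and
the function splits as `r ^ k * g θ`, so the radial integral is `1 / (d + k)`. -/
theorem lintegral_toSphere_of_homogeneous {g : F → ℝ≥0∞} {k : ℕ}
    (hom : ∀ r : ℝ, 0 < r → ∀ v, g (r • v) = ENNReal.ofReal (r ^ k) * g v)
    (hg : AEMeasurable g (μ.restrict (ball 0 1 \ {0}))) :
    AEMeasurable (fun v : sphere (0 : F) 1 ↦ g v) μ.toSphere ∧
    ∫⁻ v : sphere (0 : F) 1, g v ∂μ.toSphere =
      ((Module.finrank ℝ F + k : ℕ) : ℝ≥0∞) * ∫⁻ v in ball 0 1 \ {0}, g v ∂μ := by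
  rcases subsingleton_or_nontrivial F with hF | hF
  · have h1 : (ball (0 : F) 1 \ {0}) = ∅ := by
      ext v
      simp [Subsingleton.elim v 0]
    have h2 := μ.toSphere_eq_zero_iff.2 hF
    rw [h1, h2]
    simp
  set I : Set (Ioi (0 : ℝ)) := Iio ⟨1, mem_Ioi.2 one_pos⟩ with hI
  have hIm : MeasurableSet I := measurableSet_Iio
  set ρ := (Measure.volumeIoiPow (Module.finrank ℝ F - 1)).restrict I with hρ
  have hΦ := μ.measurePreserving_homeomorphUnitSphereProd
  have hb : MeasurableSet (ball (0 : F) 1 \ {0}) :=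
    measurableSet_ball.diff (measurableSet_singleton _)
  have h0 : MeasurableSet ({0}ᶜ : Set F) := (measurableSet_singleton _).compl
  set g' : sphere (0 : F) 1 × Ioi (0 : ℝ) → ℝ≥0∞ :=
    (univ ×ˢ I).indicator fun p ↦ ENNReal.ofReal ((p.2 : ℝ) ^ k) * g p.1 with hg'
  have hcomp : g' ∘ homeomorphUnitSphereProd F =
      (ball (0 : F) 1 \ {0}).indicator g ∘ ((↑) : ({0}ᶜ : Set F) → F) := by
    ext x
    have hx : (x : F) ≠ 0 := x.2
    have hnx : 0 < ‖(x : F)‖ := norm_pos_iff.2 hx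
    have h3 : g x = ENNReal.ofReal (‖(x : F)‖ ^ k) * g (‖(x : F)‖⁻¹ • (x : F)) := by
      rw [← hom _ hnx, smul_smul, mul_inv_cancel₀ hnx.ne', one_smul]
    have hxI : (homeomorphUnitSphereProd F x).2 ∈ I ↔ ‖(x : F)‖ < 1 := by
      rw [← homeomorphUnitSphereProd_apply_snd_coe]
      exact Iff.rfl
    by_cases hx1 : ‖(x : F)‖ < 1
    · have h4 : homeomorphUnitSphereProd F x ∈ univ ×ˢ I := ⟨mem_univ _, hxI.2 hx1⟩
      have h5 : (x : F) ∈ ball (0 : F) 1 \ {0} := ⟨mem_ball_zero_iff.2 hx1, hx⟩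
      rw [Function.comp_apply, Function.comp_apply, hg', indicator_of_mem h4, indicator_of_mem h5,
        h3, homeomorphUnitSphereProd_apply_snd_coe, homeomorphUnitSphereProd_apply_fst_coe]
    · have h4 : homeomorphUnitSphereProd F x ∉ univ ×ˢ I := fun h ↦ hx1 (hxI.1 h.2)
      have h5 : (x : F) ∉ ball (0 : F) 1 \ {0} := fun h ↦ hx1 (mem_ball_zero_iff.1 h.1)
      rw [Function.comp_apply, Function.comp_apply, hg', indicator_of_notMem h4,
        indicator_of_notMem h5]
  have hgi : AEMeasurable ((ball (0 : F) 1 \ {0}).indicator g) μ :=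
    (aemeasurable_indicator_iff hb).2 hg
  have hg'm : AEMeasurable g' (μ.toSphere.prod
      (Measure.volumeIoiPow (Module.finrank ℝ F - 1))) := by
    rw [← hΦ.aemeasurable_comp_iff (Homeomorph.measurableEmbedding _), hcomp,
      ← (MeasurableEmbedding.subtype_coe h0).aemeasurable_map_iff, map_comap_subtype_coe h0]
    exact hgi.restrict
  have hprod : (μ.toSphere.prod (Measure.volumeIoiPow (Module.finrank ℝ F - 1))).restrict
      (univ ×ˢ I) = μ.toSphere.prod ρ := by
    rw [hρ, ← Measure.prod_restrict, Measure.restrict_univ]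
  have hm2 : AEMeasurable (fun p : sphere (0 : F) 1 × Ioi (0 : ℝ) ↦
      ENNReal.ofReal ((p.2 : ℝ) ^ k) * g p.1) (μ.toSphere.prod ρ) := by
    rw [← hprod, ← aemeasurable_indicator_iff (MeasurableSet.univ.prod hIm)]
    exact hg'm
  have hρ0 : ρ ≠ 0 := by
    intro h
    have h6 := lintegral_Iio_one_volumeIoiPow (Module.finrank ℝ F - 1) k
    rw [← hI, ← hρ, h, lintegral_zero_measure] at h6
    exact ENNReal.inv_ne_zero.2 (ENNReal.natCast_ne_top _) h6.symm
  -- Measurability on the sphere comes from the ball: divide out `r ^ k`, then drop the radial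
  -- factor, which is possible as `ρ` is nonzero.
  have hm3 : AEMeasurable (fun v : sphere (0 : F) 1 ↦ g v) μ.toSphere := by
    have h7 : AEMeasurable (fun p : sphere (0 : F) 1 × Ioi (0 : ℝ) ↦ g p.1)
        (μ.toSphere.prod ρ) := by
      have h8 : AEMeasurable (fun p : sphere (0 : F) 1 × Ioi (0 : ℝ) ↦
          (ENNReal.ofReal ((p.2 : ℝ) ^ k))⁻¹) (μ.toSphere.prod ρ) := by fun_prop
      refine (h8.mul hm2).congr (Filter.Eventually.of_forall fun p ↦ ?_)
      have hp : 0 < (p.2 : ℝ) ^ k := pow_pos p.2.2 _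
      simp only [Pi.mul_apply]
      rw [← mul_assoc, ENNReal.inv_mul_cancel (by simpa using hp) ENNReal.ofReal_ne_top, one_mul]
    exact (AEStronglyMeasurable.of_comp_fst (f := fun v : sphere (0 : F) 1 ↦ g v)
      h7.aestronglyMeasurable hρ0).aemeasurable
  refine ⟨hm3, ?_⟩
  have h9 : ∫⁻ v in ball 0 1 \ {0}, g v ∂μ =
      (∫⁻ v : sphere (0 : F) 1, g v ∂μ.toSphere) *
        ((Module.finrank ℝ F + k : ℕ) : ℝ≥0∞)⁻¹ := by
    have h10 : ∫⁻ v in ball 0 1 \ {0}, g v ∂μ = ∫⁻ p, ENNReal.ofReal ((p.2 : ℝ) ^ k) * g p.1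
        ∂(μ.toSphere.prod ρ) := by
      rw [← hprod, ← lintegral_indicator (MeasurableSet.univ.prod hIm), ← hg',
        ← hΦ.lintegral_comp_emb (Homeomorph.measurableEmbedding _)]
      change _ = ∫⁻ x, (g' ∘ homeomorphUnitSphereProd F) x ∂_
      rw [hcomp, ← lintegral_indicator hb]
      refine Eq.trans ?_ (lintegral_subtype_comap h0 ((ball (0 : F) 1 \ {0}).indicator g)).symm
      rw [← lintegral_indicator h0, indicator_indicator, inter_eq_right.2 fun x hx ↦ hx.2]
    rw [h10]
    have h11 := lintegral_prod_mul hm3 (ν := ρ)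
      (g := fun r ↦ ENNReal.ofReal ((r : ℝ) ^ k)) (by fun_prop)
    simp only [mul_comm (g _)] at h11
    rw [h11, hρ, lintegral_Iio_one_volumeIoiPow]
    congr 3
    have := Module.finrank_pos (R := ℝ) (M := F)
    omega
  have hne : ((Module.finrank ℝ F + k : ℕ) : ℝ≥0∞) ≠ 0 := by
    have := Module.finrank_pos (R := ℝ) (M := F)
    exact_mod_cast (by omega)
  rw [h9, mul_comm, mul_assoc, ENNReal.inv_mul_cancel hne (ENNReal.natCast_ne_top _), mul_one]

end Polar

/-! ### The Riemannian volume in charts -/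

section Gram

variable {T : Type*} [NormedAddCommGroup T] [InnerProductSpace ℝ T] {m : ℕ}

/-- In orthonormal coordinates the Gram matrix is `X Xᵀ`. -/
theorem sqrt_det_gram_eq_abs_det (e : OrthonormalBasis (Fin m) ℝ T) (X : Fin m → T) :
    √(Matrix.gram ℝ X).det = |(Matrix.of fun i k ↦ ⟪X i, e k⟫_ℝ).det| := by
  have h : Matrix.gram ℝ X = (Matrix.of fun i k ↦ ⟪X i, e k⟫_ℝ) *
      (Matrix.of fun i k ↦ ⟪X i, e k⟫_ℝ).transpose := by
    ext i j
    rw [Matrix.gram_apply, ← e.sum_inner_mul_inner, Matrix.mul_apply]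
    simp [real_inner_comm]
  rw [h, Matrix.det_mul, Matrix.det_transpose, ← sq, Real.sqrt_sq_eq_abs]

theorem sqrt_det_gram_sum (e : OrthonormalBasis (Fin m) ℝ T)
    (C : Matrix (Fin m) (Fin m) ℝ) (X : Fin m → T) :
    √(Matrix.gram ℝ fun i ↦ ∑ k, C i k • X k).det = |C.det| * √(Matrix.gram ℝ X).det := by
  rw [sqrt_det_gram_eq_abs_det e, sqrt_det_gram_eq_abs_det e, ← abs_mul, ← Matrix.det_mul]
  congr 2
  ext i j
  simp [Matrix.mul_apply, sum_inner, inner_smul_left]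

theorem clm_apply_eq_sum_single {T : Type*} [AddCommGroup T] [Module ℝ T] [TopologicalSpace T]
    (D : EuclideanSpace ℝ (Fin m) →L[ℝ] T)
    (w : EuclideanSpace ℝ (Fin m)) : D w = ∑ k, w k • D (EuclideanSpace.single k 1) := by
  conv_lhs => rw [← (EuclideanSpace.basisFun (Fin m) ℝ).sum_repr w]
  simp

end Gram

/-! ### The volume density and its change under transition maps -/

section ChartVolume

theorem ContinuousOn.measurableSet_inter_preimage {α β : Type*} [TopologicalSpace α]
    [MeasurableSpace α] [OpensMeasurableSpace α] [TopologicalSpace β] [MeasurableSpace β]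
    [BorelSpace β] {f : α → β} {s : Set α} (hf : ContinuousOn f s) (hs : MeasurableSet s)
    {t : Set β} (ht : MeasurableSet t) : MeasurableSet (s ∩ f ⁻¹' t) := by
  have h := hs.subtype_image ((continuousOn_iff_continuous_domRestrict.1 hf).measurable ht)
  convert! h using 1
  ext x
  simp [and_comm]

variable {m : ℕ} {M : Type*} [TopologicalSpace M] [ChartedSpace (EuclideanSpace ℝ (Fin m)) M]
  [IsManifold (𝓡 m) ∞ M]

theorem mdifferentiableAt_extChartAt_symm {x₀ : M} {z : EuclideanSpace ℝ (Fin m)}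
    (hz : z ∈ (extChartAt (𝓡 m) x₀).target) :
    MDifferentiableAt 𝓘(ℝ, EuclideanSpace ℝ (Fin m)) (𝓡 m) (extChartAt (𝓡 m) x₀).symm z :=
  ((contMDiffOn_extChartAt_symm (I := 𝓡 m) (n := ∞) x₀).contMDiffAt
    ((isOpen_extChartAt_target x₀).mem_nhds hz)).mdifferentiableAt (by simp)

theorem bijective_mfderiv_extChartAt_symm {x₀ : M} {z : EuclideanSpace ℝ (Fin m)}
    (hz : z ∈ (extChartAt (𝓡 m) x₀).target) : Function.Bijective
      (mfderiv 𝓘(ℝ, EuclideanSpace ℝ (Fin m)) (𝓡 m) (extChartAt (𝓡 m) x₀).symm z) := by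
  have := isInvertible_mfderivWithin_extChartAt_symm (I := 𝓡 m) hz
  rw [ModelWithCorners.range_eq_univ, mfderivWithin_univ] at this
  exact this.bijective

theorem differentiableAt_extChartAt_comp_symm {x₀ x₁ : M} {y : EuclideanSpace ℝ (Fin m)}
    (hy : y ∈ (extChartAt (𝓡 m) x₀).target)
    (hy₁ : (extChartAt (𝓡 m) x₀).symm y ∈ (extChartAt (𝓡 m) x₁).source) :
    DifferentiableAt ℝ (extChartAt (𝓡 m) x₁ ∘ (extChartAt (𝓡 m) x₀).symm) y := by
  rw [← mdifferentiableAt_iff_differentiableAt]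
  rw [extChartAt_source] at hy₁
  exact (mdifferentiableAt_extChartAt hy₁).comp y (mdifferentiableAt_extChartAt_symm hy)

/-- The chain rule for the change of coordinates. -/
theorem mfderiv_extChartAt_symm_eq {x₀ x₁ : M} {y : EuclideanSpace ℝ (Fin m)}
    (hy : y ∈ (extChartAt (𝓡 m) x₀).target)
    (hy₁ : (extChartAt (𝓡 m) x₀).symm y ∈ (extChartAt (𝓡 m) x₁).source)
    (w : EuclideanSpace ℝ (Fin m)) :
    (mfderiv 𝓘(ℝ, EuclideanSpace ℝ (Fin m)) (𝓡 m) (extChartAt (𝓡 m) x₀).symm y w :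
      EuclideanSpace ℝ (Fin m)) =
    (mfderiv 𝓘(ℝ, EuclideanSpace ℝ (Fin m)) (𝓡 m) (extChartAt (𝓡 m) x₁).symm
      (extChartAt (𝓡 m) x₁ ((extChartAt (𝓡 m) x₀).symm y))
      (fderiv ℝ (extChartAt (𝓡 m) x₁ ∘ (extChartAt (𝓡 m) x₀).symm) y w) :
      EuclideanSpace ℝ (Fin m)) := by
  set φ₀ := extChartAt (𝓡 m) x₀
  set φ₁ := extChartAt (𝓡 m) x₁
  have hev : φ₁.symm ∘ (φ₁ ∘ φ₀.symm) =ᶠ[nhds y] φ₀.symm := by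
    have h1 : ContinuousAt φ₀.symm y := (mdifferentiableAt_extChartAt_symm hy).continuousAt
    filter_upwards [h1 ((isOpen_extChartAt_source x₁).mem_nhds hy₁)] with z hz
    exact φ₁.left_inv hz
  have h2 : MDifferentiableAt 𝓘(ℝ, EuclideanSpace ℝ (Fin m)) 𝓘(ℝ, EuclideanSpace ℝ (Fin m))
      (φ₁ ∘ φ₀.symm) y :=
    mdifferentiableAt_iff_differentiableAt.2 (differentiableAt_extChartAt_comp_symm hy hy₁)
  have h3 : MDifferentiableAt 𝓘(ℝ, EuclideanSpace ℝ (Fin m)) (𝓡 m) φ₁.symm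
      ((φ₁ ∘ φ₀.symm) y) := mdifferentiableAt_extChartAt_symm (φ₁.map_source hy₁)
  have h4 := mfderiv_comp y h3 h2
  have h5 := hev.mfderiv_eq (I := 𝓘(ℝ, EuclideanSpace ℝ (Fin m))) (I' := 𝓡 m)
  rw [mfderiv_eq_fderiv] at h4
  have h6 := DFunLike.congr_fun h4 w
  refine Eq.trans ?_ h6
  exact (DFunLike.congr_fun h5 w).symm

variable [RiemannianBundle (fun x : M ↦ TangentSpace (𝓡 m) x)]

/-- An orthonormal basis of the tangent space. -/
noncomputable def tangentBasis (x : M) : OrthonormalBasis (Fin m) ℝ (TangentSpace (𝓡 m) x) :=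
  (stdOrthonormalBasis ℝ (TangentSpace (𝓡 m) x)).reindex (finCongr (finrank_tangentSpace_eq x))

/-- The coordinate fields of one chart are combinations of those of the other, with the Jacobian
matrix of the transition map as coefficients. -/
theorem volumeDensity_eq_abs_det_mul {x₀ x₁ : M} {y : EuclideanSpace ℝ (Fin m)}
    (hy : y ∈ (extChartAt (𝓡 m) x₀).target)
    (hy₁ : (extChartAt (𝓡 m) x₀).symm y ∈ (extChartAt (𝓡 m) x₁).source) :
    volumeDensity x₀ y =
      |(fderiv ℝ (extChartAt (𝓡 m) x₁ ∘ (extChartAt (𝓡 m) x₀).symm) y).det| *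
        volumeDensity x₁ (extChartAt (𝓡 m) x₁ ((extChartAt (𝓡 m) x₀).symm y)) := by
  set φ₀ := extChartAt (𝓡 m) x₀
  set φ₁ := extChartAt (𝓡 m) x₁
  set τ' := fderiv ℝ (φ₁ ∘ φ₀.symm) y
  -- The two frames live over points that are equal only propositionally; their vectors are compared
  -- in the model space.
  have hpt : ∀ p q : M, p = q → ∀ (X : Fin m → TangentSpace (𝓡 m) p)
      (Y : Fin m → TangentSpace (𝓡 m) q), (∀ i, (X i : EuclideanSpace ℝ (Fin m)) = Y i) →
      √(Matrix.gram ℝ X).det = √(Matrix.gram ℝ Y).det := by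
    rintro p _ rfl X Y h
    obtain rfl : X = Y := funext h
    rfl
  let C : Matrix (Fin m) (Fin m) ℝ := Matrix.of fun i k ↦ τ' (EuclideanSpace.single i 1) k
  have hC : C.det = τ'.det := by
    change _ = LinearMap.det τ'.toLinearMap
    rw [← LinearMap.det_toMatrix (EuclideanSpace.basisFun (Fin m) ℝ).toBasis,
      ← Matrix.det_transpose]
    congr 1
  rw [← hC]
  unfold volumeDensity
  refine Eq.trans ?_ (sqrt_det_gram_sum (tangentBasis (φ₁.symm (φ₁ (φ₀.symm y)))) C
    (coordField x₁ (φ₁ (φ₀.symm y))))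
  refine hpt _ _ (φ₁.left_inv hy₁).symm _ _ fun i ↦ ?_
  refine (mfderiv_extChartAt_symm_eq hy hy₁ _).trans ?_
  exact clm_apply_eq_sum_single (mfderiv 𝓘(ℝ, EuclideanSpace ℝ (Fin m)) (𝓡 m)
    φ₁.symm (φ₁ (φ₀.symm y))) (τ' (EuclideanSpace.single i 1))

theorem volumeDensity_pos {x₀ : M} {y : EuclideanSpace ℝ (Fin m)}
    (hy : y ∈ (extChartAt (𝓡 m) x₀).target) : 0 < volumeDensity x₀ y := by
  refine Real.sqrt_pos.2 (Matrix.PosDef.det_pos ?_)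
  refine Matrix.posDef_gram_of_linearIndependent ?_
  have := (EuclideanSpace.basisFun (Fin m) ℝ).toBasis.linearIndependent.map'
    (mfderiv 𝓘(ℝ, EuclideanSpace ℝ (Fin m)) (𝓡 m) (extChartAt (𝓡 m) x₀).symm y).toLinearMap
    (LinearMap.ker_eq_bot.2 (bijective_mfderiv_extChartAt_symm hy).1)
  convert! this using 1
  ext1 i
  rw [Function.comp_apply, OrthonormalBasis.coe_toBasis, EuclideanSpace.basisFun_apply]
  rfl

theorem continuousOn_volumeDensity [IsContMDiffRiemannianBundle (𝓡 m) ∞ (EuclideanSpace ℝ (Fin m))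
    (fun x : M ↦ TangentSpace (𝓡 m) x)] (x₀ : M) :
    ContinuousOn (volumeDensity x₀) (extChartAt (𝓡 m) x₀).target := by
  have : IsContinuousRiemannianBundle (EuclideanSpace ℝ (Fin m))
      (fun x : M ↦ TangentSpace (𝓡 m) x) := by
    obtain ⟨g, hg, h⟩ := IsContMDiffRiemannianBundle.exists_contMDiff (IB := 𝓡 m) (n := ∞)
      (F := EuclideanSpace ℝ (Fin m)) (E := fun x : M ↦ TangentSpace (𝓡 m) x)
    exact ⟨g, hg.continuous, h⟩
  have hcont : ∀ i, ContinuousOn (fun y ↦ (⟨(extChartAt (𝓡 m) x₀).symm y, coordField x₀ y i⟩ :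
      TotalSpace (EuclideanSpace ℝ (Fin m)) (fun x : M ↦ TangentSpace (𝓡 m) x)))
      (extChartAt (𝓡 m) x₀).target := by
    intro i
    set φ := extChartAt (𝓡 m) x₀
    have hopen : IsOpen φ.target := isOpen_extChartAt_target x₀
    have h1 := (contMDiffOn_extChartAt_symm (I := 𝓡 m) (n := ∞)
      x₀).continuousOn_tangentMapWithin (by simp) hopen.uniqueMDiffOn
    have h2 : Continuous (fun y : EuclideanSpace ℝ (Fin m) ↦
        (⟨y, EuclideanSpace.single i 1⟩ :
          TangentBundle 𝓘(ℝ, EuclideanSpace ℝ (Fin m)) (EuclideanSpace ℝ (Fin m)))) :=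
      (tangentBundleModelSpaceHomeomorph 𝓘(ℝ, EuclideanSpace ℝ (Fin m))).symm.continuous.comp
        (continuous_id.prodMk continuous_const)
    refine (h1.comp h2.continuousOn fun y hy ↦ hy).congr fun y hy ↦ ?_
    simp only [Function.comp_apply, tangentMapWithin, coordField]
    rw [mfderivWithin_of_isOpen hopen hy]
  have hg : ContinuousOn (fun y ↦ Matrix.gram ℝ (coordField x₀ y))
      (extChartAt (𝓡 m) x₀).target := by
    refine continuousOn_pi.2 fun i ↦ continuousOn_pi.2 fun j ↦ ?_
    exact (hcont i).inner_bundle (hcont j)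
  exact Real.continuous_sqrt.comp_continuousOn
    ((Continuous.matrix_det continuous_id).comp_continuousOn hg)

end ChartVolume

/-! ### The Riemannian measure and integration in a chart -/

section RiemannianVolume

variable {m : ℕ} {M : Type*} [TopologicalSpace M] [ChartedSpace (EuclideanSpace ℝ (Fin m)) M]
  [MeasurableSpace M] [BorelSpace M]

theorem measurableSet_target_inter_preimage (x₀ : M) {A : Set M} (hA : MeasurableSet A) :
    MeasurableSet ((extChartAt (𝓡 m) x₀).target ∩ (extChartAt (𝓡 m) x₀).symm ⁻¹' A) :=
  (continuousOn_extChartAt_symm x₀).measurableSet_inter_preimage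
    (isOpen_extChartAt_target x₀).measurableSet hA

variable [RiemannianBundle (fun x : M ↦ TangentSpace (𝓡 m) x)]

theorem chartVolume_apply (x₀ : M) {A : Set M} (hA : MeasurableSet A) :
    chartVolume (m := m) x₀ A =
      ∫⁻ y in (extChartAt (𝓡 m) x₀).target ∩ (extChartAt (𝓡 m) x₀).symm ⁻¹' A,
        ENNReal.ofReal (volumeDensity x₀ y) := by
  set φ := extChartAt (𝓡 m) x₀
  have ht : MeasurableSet φ.target := (isOpen_extChartAt_target x₀).measurableSet
  have h1 : AEMeasurable φ.symm (volume.restrict φ.target) :=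
    (continuousOn_extChartAt_symm x₀).aemeasurable ht
  have h2 : AEMeasurable φ.symm ((volume.restrict φ.target).withDensity
      fun y ↦ ENNReal.ofReal (volumeDensity x₀ y)) :=
    h1.mono_ac (withDensity_absolutelyContinuous _ _)
  have h3 := measurableSet_target_inter_preimage (m := m) x₀ hA
  rw [chartVolume, Measure.map_apply_of_aemeasurable h2 hA]
  have h5 : ((volume.restrict φ.target).withDensity
      fun y ↦ ENNReal.ofReal (volumeDensity x₀ y)) (φ.symm ⁻¹' A) =
      ((volume.restrict φ.target).withDensity
        fun y ↦ ENNReal.ofReal (volumeDensity x₀ y)) (φ.target ∩ φ.symm ⁻¹' A) := by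
    refine measure_congr ?_
    have h6 : ∀ᵐ y ∂((volume.restrict φ.target).withDensity
        fun y ↦ ENNReal.ofReal (volumeDensity x₀ y)), y ∈ φ.target :=
      (withDensity_absolutelyContinuous _ _).ae_le (ae_restrict_mem ht)
    filter_upwards [h6] with y hy
    exact propext ⟨fun h ↦ ⟨hy, h⟩, fun h ↦ h.2⟩
  rw [h5, withDensity_apply _ h3, Measure.restrict_restrict h3, inter_assoc, inter_comm,
    inter_assoc, inter_self, inter_comm]

variable [IsManifold (𝓡 m) ∞ M]

/-- Change of variables along the transition map. There is only an inequality because the chart at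
`x₁` need not cover `A`. -/
theorem chartVolume_le (x₀ x₁ : M) {A : Set M} (hA : MeasurableSet A)
    (hA₀ : A ⊆ (extChartAt (𝓡 m) x₀).source) :
    chartVolume (m := m) x₁ A ≤ chartVolume (m := m) x₀ A := by
  rw [chartVolume_apply x₁ hA, chartVolume_apply x₀ hA]
  set φ₀ := extChartAt (𝓡 m) x₀ with hφ₀
  set φ₁ := extChartAt (𝓡 m) x₁ with hφ₁
  set s := φ₁.target ∩ φ₁.symm ⁻¹' A with hs
  have hsm : MeasurableSet s := measurableSet_target_inter_preimage (m := m) x₁ hA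
  have hinj : InjOn (φ₀ ∘ φ₁.symm) s := by
    intro y hy z hz h
    exact φ₁.symm.injOn hy.1 hz.1 (φ₀.injOn (hA₀ hy.2) (hA₀ hz.2) h)
  have hder : ∀ y ∈ s, HasFDerivWithinAt (φ₀ ∘ φ₁.symm) (fderiv ℝ (φ₀ ∘ φ₁.symm) y) s y :=
    fun y hy ↦ (differentiableAt_extChartAt_comp_symm hy.1
      (hA₀ hy.2)).hasFDerivAt.hasFDerivWithinAt
  calc ∫⁻ y in s, ENNReal.ofReal (volumeDensity x₁ y)
      = ∫⁻ y in s, ENNReal.ofReal |(fderiv ℝ (φ₀ ∘ φ₁.symm) y).det| *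
          ENNReal.ofReal (volumeDensity x₀ ((φ₀ ∘ φ₁.symm) y)) := by
        refine setLIntegral_congr_fun hsm fun y hy ↦ ?_
        rw [volumeDensity_eq_abs_det_mul hy.1 (hA₀ hy.2), ENNReal.ofReal_mul (abs_nonneg _)]
        rfl
    _ = ∫⁻ y in (φ₀ ∘ φ₁.symm) '' s, ENNReal.ofReal (volumeDensity x₀ y) :=
        (lintegral_image_eq_lintegral_abs_det_fderiv_mul volume hsm hder hinj
          fun y ↦ ENNReal.ofReal (volumeDensity x₀ y)).symm
    _ ≤ _ := by
        refine lintegral_mono_set ?_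
        rintro _ ⟨y, hy, rfl⟩
        refine ⟨φ₀.map_source (hA₀ hy.2), ?_⟩
        rw [mem_preimage, Function.comp_apply, φ₀.left_inv (hA₀ hy.2)]
        exact hy.2

/-- On the domain of a chart the Riemannian volume is the one computed in the chart. -/
theorem riemannianVolume_apply_of_subset_source (x₀ : M) {A : Set M} (hA : MeasurableSet A)
    (hA₀ : A ⊆ (extChartAt (𝓡 m) x₀).source) :
    riemannianVolume m M A = chartVolume (m := m) x₀ A := by
  refine le_antisymm ?_ (Measure.le_iff'.1 (le_iSup (fun x₀ : M ↦ chartVolume (m := m) x₀) x₀) A)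
  set S := (extChartAt (𝓡 m) x₀).source
  have hS : MeasurableSet S := (isOpen_extChartAt_source x₀).measurableSet
  -- A supremum of measures is not computed set by set, so it is bounded by a single measure
  -- dominating every chart volume: that of `x₀`, plus the Riemannian volume off the domain of its
  -- chart.
  have hle : riemannianVolume m M ≤
      chartVolume (m := m) x₀ + (riemannianVolume m M).restrict Sᶜ := by
    refine iSup_le fun x₁ ↦ Measure.le_iff.2 fun B hB ↦ ?_
    rw [Measure.add_apply, Measure.restrict_apply hB, ← measure_inter_add_sdiff B hS]
    refine add_le_add ((chartVolume_le x₀ x₁ (hB.inter hS) inter_subset_right).trans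
      (measure_mono inter_subset_left)) ?_
    exact Measure.le_iff'.1 (le_iSup (fun x₀ : M ↦ chartVolume (m := m) x₀) x₁) _
  refine (Measure.le_iff'.1 hle A).trans ?_
  rw [Measure.add_apply, Measure.restrict_apply hA,
    disjoint_iff_inter_eq_empty.1 (disjoint_compl_right_iff_subset.2 hA₀), measure_empty, add_zero]

theorem map_extChartAt_riemannianVolume (x₀ : M) {A : Set M} (hA : MeasurableSet A)
    (hA₀ : A ⊆ (extChartAt (𝓡 m) x₀).source) :
    ((riemannianVolume m M).restrict A).map (extChartAt (𝓡 m) x₀) =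
      (volume.restrict ((extChartAt (𝓡 m) x₀).target ∩
        (extChartAt (𝓡 m) x₀).symm ⁻¹' A)).withDensity
        fun y ↦ ENNReal.ofReal (volumeDensity x₀ y) := by
  set φ := extChartAt (𝓡 m) x₀
  have hc : ContinuousOn φ A := (continuousOn_extChartAt x₀).mono hA₀
  have hm : AEMeasurable φ ((riemannianVolume m M).restrict A) := hc.aemeasurable hA
  ext B hB
  have h1 : MeasurableSet (A ∩ φ ⁻¹' B) := hc.measurableSet_inter_preimage hA hB
  have h2 : ((riemannianVolume m M).restrict A) (φ ⁻¹' B) = riemannianVolume m M (A ∩ φ ⁻¹' B) := by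
    rw [Measure.restrict_apply₀ (hm.nullMeasurable hB), inter_comm]
  rw [Measure.map_apply_of_aemeasurable hm hB, h2,
    riemannianVolume_apply_of_subset_source x₀ h1 (inter_subset_left.trans hA₀),
    chartVolume_apply x₀ h1, withDensity_apply _ hB, Measure.restrict_restrict hB]
  congr 2
  ext y
  constructor
  · rintro ⟨hy, hyA, hyB⟩
    exact ⟨(congrArg (fun w ↦ w ∈ B) (φ.right_inv hy)).mp hyB, hy, hyA⟩
  · rintro ⟨hyB, hy, hyA⟩
    exact ⟨hy, hyA, (congrArg (fun w ↦ w ∈ B) (φ.right_inv hy)).mpr hyB⟩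

variable [IsContMDiffRiemannianBundle (𝓡 m) ∞ (EuclideanSpace ℝ (Fin m))
    (fun x : M ↦ TangentSpace (𝓡 m) x)]

/-- Integration against the Riemannian volume in a chart. -/
theorem lintegral_riemannianVolume (x₀ : M) {A : Set M} (hA : MeasurableSet A)
    (hA₀ : A ⊆ (extChartAt (𝓡 m) x₀).source) {g : M → ℝ≥0∞}
    {H : EuclideanSpace ℝ (Fin m) → ℝ≥0∞} (hgH : ∀ y ∈ (extChartAt (𝓡 m) x₀).target ∩
      (extChartAt (𝓡 m) x₀).symm ⁻¹' A, ENNReal.ofReal (volumeDensity x₀ y) *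
        g ((extChartAt (𝓡 m) x₀).symm y) = H y)
    (hH : AEMeasurable H (volume.restrict ((extChartAt (𝓡 m) x₀).target ∩
      (extChartAt (𝓡 m) x₀).symm ⁻¹' A))) :
    AEMeasurable g ((riemannianVolume m M).restrict A) ∧
    ∫⁻ x in A, g x ∂riemannianVolume m M =
      ∫⁻ y in (extChartAt (𝓡 m) x₀).target ∩ (extChartAt (𝓡 m) x₀).symm ⁻¹' A, H y := by
  set φ := extChartAt (𝓡 m) x₀
  set s := φ.target ∩ φ.symm ⁻¹' A
  have hs : MeasurableSet s := measurableSet_target_inter_preimage (m := m) x₀ hA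
  have hm : AEMeasurable φ ((riemannianVolume m M).restrict A) :=
    ((continuousOn_extChartAt x₀).mono hA₀).aemeasurable hA
  have hmap := map_extChartAt_riemannianVolume x₀ hA hA₀
  have hρ : AEMeasurable (fun y ↦ ENNReal.ofReal (volumeDensity x₀ y)) (volume.restrict s) :=
    ENNReal.measurable_ofReal.comp_aemeasurable
      (((continuousOn_volumeDensity x₀).mono inter_subset_left).aemeasurable hs)
  -- Measurability is known only for the product `H` with the density; the positive density is
  -- divided out to recover `g`.
  set H' : EuclideanSpace ℝ (Fin m) → ℝ≥0∞ :=
    fun y ↦ (ENNReal.ofReal (volumeDensity x₀ y))⁻¹ * H y with hH'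
  have hH'm : AEMeasurable H' (volume.restrict s) := hρ.inv.mul hH
  have hpos : ∀ y ∈ s, ENNReal.ofReal (volumeDensity x₀ y) ≠ 0 := fun y hy ↦
    (ENNReal.ofReal_pos.2 (volumeDensity_pos hy.1)).ne'
  have hgH' : ∀ y ∈ s, g (φ.symm y) = H' y := by
    intro y hy
    simp only [hH']
    rw [← hgH y hy, ← mul_assoc, ENNReal.inv_mul_cancel (hpos y hy) ENNReal.ofReal_ne_top,
      one_mul]
  have hA' : ∀ x ∈ A, H' (φ x) = g x := by
    intro x hx
    rw [← hgH' (φ x) ⟨φ.map_source (hA₀ hx), by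
      rw [mem_preimage, φ.left_inv (hA₀ hx)]; exact hx⟩, φ.left_inv (hA₀ hx)]
  have hH'map : AEMeasurable H' (((riemannianVolume m M).restrict A).map φ) := by
    rw [hmap]
    exact hH'm.mono_ac (withDensity_absolutelyContinuous _ _)
  have hae : H' ∘ φ =ᵐ[(riemannianVolume m M).restrict A] g := by
    filter_upwards [ae_restrict_mem hA] with x hx using hA' x hx
  refine ⟨(hH'map.comp_aemeasurable hm).congr hae, ?_⟩
  rw [← lintegral_congr_ae hae]
  simp only [Function.comp_apply]
  rw [← lintegral_map' hH'map hm, hmap, lintegral_withDensity_eq_lintegral_mul₀ hρ hH'm]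
  refine setLIntegral_congr_fun hs fun y hy ↦ ?_
  simp only [Pi.mul_apply, hH']
  rw [← mul_assoc, ENNReal.mul_inv_cancel (hpos y hy) ENNReal.ofReal_ne_top, one_mul]

end RiemannianVolume

/-! ### The critical spaces and the shape operator in charts -/

section Charts

theorem inner_apply_eq_sum {T P K : Type*} [NormedAddCommGroup T] [InnerProductSpace ℝ T]
    [AddCommGroup P] [Module ℝ P] [NormedAddCommGroup K] [InnerProductSpace ℝ K]
    (Ξ : T →ₗ[ℝ] P →ₗ[ℝ] K) {k : ℕ} (e : OrthonormalBasis (Fin k) ℝ T) (X : T) (u : P) (v : K) :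
    ⟪Ξ X u, v⟫_ℝ = ∑ i, ⟪X, e i⟫_ℝ * ⟪Ξ (e i) u, v⟫_ℝ := by
  conv_lhs => rw [← e.sum_repr' X]
  simp [sum_inner, inner_smul_left, real_inner_comm]

/-- An isometric embedding, as an isometry onto its range. -/
theorem exists_linearIsometryEquiv_of_range_eq {U : Type*} [NormedAddCommGroup U]
    [InnerProductSpace ℝ U] {E : Type*} [NormedAddCommGroup E] [InnerProductSpace ℝ E]
    (a : U →L[ℝ] E) (ha : ∀ x, ‖a x‖ = ‖x‖) (K : Submodule ℝ E)
    (hK : LinearMap.range a.toLinearMap = K) :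
    ∃ L : U ≃ₗᵢ[ℝ] K, ∀ x, (L x : E) = a x := by
  subst hK
  exact ⟨(LinearIsometry.mk a.toLinearMap ha).equivRange, fun x ↦ rfl⟩

variable {m : ℕ} {M : Type*} [TopologicalSpace M] [ChartedSpace (EuclideanSpace ℝ (Fin m)) M]
  {E : Type*} [NormedAddCommGroup E] [InnerProductSpace ℝ E] [FiniteDimensional ℝ E]

/-- In the chart at `x₀`, the map to `E` that represents the evaluations of the functions of the
family. -/
noncomputable def evalVector (ι : E →ₗ[ℝ] C^∞⟮𝓡 m, M; ℝ⟯) (x₀ : M)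
    (z : EuclideanSpace ℝ (Fin m)) : E :=
  ∑ a, ι (stdOrthonormalBasis ℝ E a) ((extChartAt (𝓡 m) x₀).symm z) • stdOrthonormalBasis ℝ E a

/-- Riesz representation of evaluation at a point. Differentiating in `z` represents the
differentials, which makes `K^⊥` the range of a `C^1` family of linear maps. -/
theorem inner_evalVector (ι : E →ₗ[ℝ] C^∞⟮𝓡 m, M; ℝ⟯) (x₀ : M) (v : E)
    (z : EuclideanSpace ℝ (Fin m)) :
    ⟪v, evalVector ι x₀ z⟫_ℝ = ι v ((extChartAt (𝓡 m) x₀).symm z) := by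
  let l : E →ₗ[ℝ] ℝ :=
    { toFun := fun v ↦ ι v ((extChartAt (𝓡 m) x₀).symm z)
      map_add' := fun v w ↦ by rw [map_add, ContMDiffMap.coe_add, Pi.add_apply]
      map_smul' := fun c v ↦ by rw [map_smul, ContMDiffMap.coe_smul, Pi.smul_apply]; rfl }
  change _ = l v
  conv_rhs => rw [← (stdOrthonormalBasis ℝ E).sum_repr' v]
  simp only [evalVector, inner_sum, inner_smul_right, map_sum, map_smul]
  refine Finset.sum_congr rfl fun a _ ↦ ?_
  rw [smul_eq_mul, mul_comm, real_inner_comm]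
  rfl

theorem IsAmple.finrank_criticalSpace_add {ι : E →ₗ[ℝ] C^∞⟮𝓡 m, M; ℝ⟯} (hι : IsAmple ι) (x : M) :
    Module.finrank ℝ (criticalSpace ι x) + m = Module.finrank ℝ E := by
  have h := (criticalSpace ι x).finrank_add_finrank_orthogonal
  rwa [hι.finrank_orthogonal x] at h

variable [IsManifold (𝓡 m) ∞ M]

theorem contDiffOn_evalVector (ι : E →ₗ[ℝ] C^∞⟮𝓡 m, M; ℝ⟯) (x₀ : M) :
    ContDiffOn ℝ ∞ (evalVector ι x₀) (extChartAt (𝓡 m) x₀).target :=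
  ContDiffOn.sum fun a _ ↦ ContDiffOn.smul (contMDiffOn_iff_contDiffOn.1
    ((ι (stdOrthonormalBasis ℝ E a)).contMDiff.comp_contMDiffOn
      (contMDiffOn_extChartAt_symm x₀))) contDiffOn_const

theorem contDiffOn_fderiv_evalVector (ι : E →ₗ[ℝ] C^∞⟮𝓡 m, M; ℝ⟯) (x₀ : M) :
    ContDiffOn ℝ 1 (fderiv ℝ (evalVector ι x₀)) (extChartAt (𝓡 m) x₀).target :=
  (contDiffOn_evalVector ι x₀).fderiv_of_isOpen (isOpen_extChartAt_target x₀) (by norm_cast)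

theorem inner_fderiv_evalVector (ι : E →ₗ[ℝ] C^∞⟮𝓡 m, M; ℝ⟯) {x₀ : M}
    {z : EuclideanSpace ℝ (Fin m)} (hz : z ∈ (extChartAt (𝓡 m) x₀).target) (v : E)
    (w : EuclideanSpace ℝ (Fin m)) :
    ⟪v, fderiv ℝ (evalVector ι x₀) z w⟫_ℝ = adjunction ι ((extChartAt (𝓡 m) x₀).symm z) v
      (mfderiv 𝓘(ℝ, EuclideanSpace ℝ (Fin m)) (𝓡 m) (extChartAt (𝓡 m) x₀).symm z w) := by
  have hGz : DifferentiableAt ℝ (evalVector ι x₀) z :=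
    ((contDiffOn_evalVector ι x₀).contDiffAt
      ((isOpen_extChartAt_target x₀).mem_nhds hz)).differentiableAt (by simp)
  have h1 : fderiv ℝ (fun z ↦ ⟪v, evalVector ι x₀ z⟫_ℝ) z w =
      ⟪v, fderiv ℝ (evalVector ι x₀) z w⟫_ℝ := by
    have := ((innerSL ℝ v).hasFDerivAt.comp z hGz.hasFDerivAt).fderiv
    exact DFunLike.congr_fun this w
  rw [← h1]
  simp only [inner_evalVector]
  have h2 := mvfderiv_comp_apply z ((ι v).contMDiff.mdifferentiable (by simp) _)
    (mdifferentiableAt_extChartAt_symm hz) w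
  refine Eq.trans ?_ h2
  rw [mvfderiv, mfderiv_eq_fderiv]
  rfl

/-- The derivative of `evalVector` represents `d v` on coordinate vectors, and these span the
tangent space. -/
theorem criticalSpace_eq_orthogonal_range (ι : E →ₗ[ℝ] C^∞⟮𝓡 m, M; ℝ⟯) {x₀ : M}
    {z : EuclideanSpace ℝ (Fin m)} (hz : z ∈ (extChartAt (𝓡 m) x₀).target) :
    criticalSpace ι ((extChartAt (𝓡 m) x₀).symm z) =
      (LinearMap.range (fderiv ℝ (evalVector ι x₀) z).toLinearMap)ᗮ := by
  ext v
  rw [Submodule.mem_orthogonal']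
  constructor
  · rintro hv _ ⟨w, rfl⟩
    exact (inner_fderiv_evalVector ι hz v w).trans (DFunLike.congr_fun (LinearMap.mem_ker.1 hv) _)
  · intro hv
    refine LinearMap.mem_ker.2 (ContinuousLinearMap.ext fun X ↦ ?_)
    obtain ⟨w, rfl⟩ := (bijective_mfderiv_extChartAt_symm hz).2 X
    exact (inner_fderiv_evalVector ι hz v w).symm.trans (hv _ ⟨w, rfl⟩)

variable {ι : E →ₗ[ℝ] C^∞⟮𝓡 m, M; ℝ⟯}

/-- Its range is `K^⊥`, of dimension `m` by ampleness, so the kernel has dimension zero. -/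
theorem IsAmple.injective_fderiv_evalVector (hι : IsAmple ι) {x₀ : M}
    {z : EuclideanSpace ℝ (Fin m)} (hz : z ∈ (extChartAt (𝓡 m) x₀).target) :
    Function.Injective (fderiv ℝ (evalVector ι x₀) z) := by
  have h := hι.finrank_orthogonal ((extChartAt (𝓡 m) x₀).symm z)
  rw [criticalSpace_eq_orthogonal_range ι hz, Submodule.orthogonal_orthogonal] at h
  have h2 := (fderiv ℝ (evalVector ι x₀) z).toLinearMap.finrank_range_add_finrank_ker
  rw [h, finrank_euclideanSpace_fin] at h2
  exact LinearMap.ker_eq_bot.1 (Submodule.finrank_eq_zero.1 (by omega))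

/-- A pair of frames over a neighborhood of `x₀`, in the chart at `x₀`, that span the orthogonal
complements of the critical spaces, and the critical spaces. -/
structure IsCriticalFrame (ι : E →ₗ[ℝ] C^∞⟮𝓡 m, M; ℝ⟯) (x₀ : M) {n : ℕ}
    (A : EuclideanSpace ℝ (Fin m) → EuclideanSpace ℝ (Fin m) →L[ℝ] E)
    (B : EuclideanSpace ℝ (Fin m) → EuclideanSpace ℝ (Fin n) →L[ℝ] E)
    (Ω : Set (EuclideanSpace ℝ (Fin m))) : Prop extends IsFramePair A B Ω where
  subset_target : Ω ⊆ (extChartAt (𝓡 m) x₀).target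
  range_left : ∀ z ∈ Ω, LinearMap.range (A z).toLinearMap =
    (criticalSpace ι ((extChartAt (𝓡 m) x₀).symm z))ᗮ
  range_right : ∀ z ∈ Ω, LinearMap.range (B z).toLinearMap =
    criticalSpace ι ((extChartAt (𝓡 m) x₀).symm z)

/-- The frames are those of the derivative of `evalVector`. The range of `B z` is orthogonal to
`K^⊥`, hence inside `K`, and has the same dimension. -/
theorem IsAmple.exists_isCriticalFrame (hι : IsAmple ι) (x₀ : M) {n : ℕ}
    (hn : Module.finrank ℝ E = m + n) :
    ∃ r > 0, ∃ (A : EuclideanSpace ℝ (Fin m) → EuclideanSpace ℝ (Fin m) →L[ℝ] E)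
      (B : EuclideanSpace ℝ (Fin m) → EuclideanSpace ℝ (Fin n) →L[ℝ] E),
      IsCriticalFrame ι x₀ A B (ball (extChartAt (𝓡 m) x₀ x₀) r) := by
  obtain ⟨r, hr, hsub, A, B, hA, hB, h⟩ := exists_orthonormal_frames
    (isOpen_extChartAt_target x₀) (contDiffOn_fderiv_evalVector ι x₀)
    (fun z hz ↦ hι.injective_fderiv_evalVector hz) (mem_extChartAt_target x₀) hn
  have hrA : ∀ z ∈ ball (extChartAt (𝓡 m) x₀ x₀) r, LinearMap.range (A z).toLinearMap =
      (criticalSpace ι ((extChartAt (𝓡 m) x₀).symm z))ᗮ := fun z hz ↦ by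
    rw [(h z hz).2.2.2, criticalSpace_eq_orthogonal_range ι (hsub hz),
      Submodule.orthogonal_orthogonal]
  refine ⟨r, hr, A, B, ⟨isOpen_ball, hn, hA, hB, fun z hz ↦ (h z hz).1, fun z hz ↦ (h z hz).2.1,
    fun z hz ↦ (h z hz).2.2.1⟩, hsub, hrA, fun z hz ↦ ?_⟩
  refine Submodule.eq_of_le_of_finrank_eq ?_ ?_
  · rw [← Submodule.orthogonal_orthogonal (criticalSpace ι _), ← hrA z hz]
    rintro _ ⟨c, rfl⟩
    refine (Submodule.mem_orthogonal _ _).2 ?_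
    rintro _ ⟨a, rfl⟩
    exact (h z hz).2.2.1 a c
  · have hinj : Function.Injective (B z).toLinearMap :=
      (LinearIsometry.mk (B z).toLinearMap (h z hz).2.1).injective
    rw [LinearMap.finrank_range_of_inj hinj, finrank_euclideanSpace_fin]
    have := hι.finrank_criticalSpace_add ((extChartAt (𝓡 m) x₀).symm z)
    omega

namespace IsCriticalFrame

variable {x₀ : M} {n : ℕ}
  {A : EuclideanSpace ℝ (Fin m) → EuclideanSpace ℝ (Fin m) →L[ℝ] E}
  {B : EuclideanSpace ℝ (Fin m) → EuclideanSpace ℝ (Fin n) →L[ℝ] E}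
  {Ω : Set (EuclideanSpace ℝ (Fin m))}

theorem exists_section (h : IsCriticalFrame ι x₀ A B Ω) {z : EuclideanSpace ℝ (Fin m)}
    (hz : z ∈ Ω) (a : EuclideanSpace ℝ (Fin m)) :
    ∃ s : ∀ y : M, (criticalSpace ι y)ᗮ,
      MDifferentiableAt (𝓡 m) 𝓘(ℝ, E) (fun y ↦ (s y : E)) ((extChartAt (𝓡 m) x₀).symm z) ∧
      (s ((extChartAt (𝓡 m) x₀).symm z) : E) = A z a ∧
      ∀ w : EuclideanSpace ℝ (Fin m), mvfderiv (𝓡 m) (fun y ↦ (s y : E))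
        ((extChartAt (𝓡 m) x₀).symm z)
        (mfderiv 𝓘(ℝ, EuclideanSpace ℝ (Fin m)) (𝓡 m) (extChartAt (𝓡 m) x₀).symm z w) =
          fderiv ℝ A z w a := by
  set φ := extChartAt (𝓡 m) x₀
  have hzt : z ∈ φ.target := h.subset_target hz
  set x := φ.symm z
  have hxs : x ∈ φ.source := φ.map_target hzt
  have hφx : φ x = z := φ.right_inv hzt
  -- `shapeOperator_section` requires a section over all of `M`. Projecting onto `K_y^⊥` gives one,
  -- and changes nothing over `Ω`.
  let s : ∀ y : M, (criticalSpace ι y)ᗮ :=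
    fun y ↦ (criticalSpace ι y)ᗮ.orthogonalProjectionOnto (A (φ y) a)
  have hs : ∀ z' ∈ Ω, (s (φ.symm z') : E) = A z' a := by
    intro z' hz'
    have h1 : A z' a ∈ (criticalSpace ι (φ.symm z'))ᗮ := by
      rw [← h.range_left z' hz']
      exact ⟨a, rfl⟩
    change (criticalSpace ι (φ.symm z'))ᗮ.starProjection (A (φ (φ.symm z')) a) = _
    rw [φ.right_inv (h.subset_target hz')]
    exact Submodule.starProjection_eq_self_iff.2 h1
  have hAa : DifferentiableAt ℝ (fun z' ↦ A z' a) z :=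
    (h.differentiableAt_left hz).clm_apply (differentiableAt_const a)
  have hev : (fun y ↦ (s y : E)) =ᶠ[nhds x] fun y ↦ A (φ y) a := by
    have h2 : ContinuousAt φ x := continuousAt_extChartAt' hxs
    have h3 : ∀ᶠ y in nhds x, φ y ∈ Ω := h2 (by rw [hφx]; exact h.isOpen.mem_nhds hz)
    filter_upwards [h3, (isOpen_extChartAt_source x₀).mem_nhds hxs] with y hy hys
    have := hs (φ y) hy
    rwa [φ.left_inv hys] at this
  have hsd : MDifferentiableAt (𝓡 m) 𝓘(ℝ, E) (fun y ↦ (s y : E)) x := by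
    refine MDifferentiableAt.congr_of_eventuallyEq ?_ hev
    refine DifferentiableAt.comp_mdifferentiableAt (g := fun z' ↦ A z' a) ?_
      (mdifferentiableAt_extChartAt (by rwa [extChartAt_source] at hxs))
    rw [hφx]
    exact hAa
  refine ⟨s, hsd, hs z hz, fun w ↦ ?_⟩
  have h4 := mfderiv_comp_apply z hsd (mdifferentiableAt_extChartAt_symm hzt) w
  refine h4.symm.trans ?_
  have h5 : (fun y ↦ (s y : E)) ∘ φ.symm =ᶠ[nhds z] fun z' ↦ A z' a := by
    filter_upwards [h.isOpen.mem_nhds hz] with z' hz' using hs z' hz'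
  have h6 : fderiv ℝ ((fun y ↦ (s y : E)) ∘ φ.symm) z w = fderiv ℝ A z w a := by
    rw [h5.fderiv_eq, fderiv_clm_apply (h.differentiableAt_left hz) (differentiableAt_const a)]
    simp
  rw [← h6, mfderiv_eq_fderiv]
  rfl

theorem inner_shapeOperator (h : IsCriticalFrame ι x₀ A B Ω) (hι : IsAmple ι)
    {z : EuclideanSpace ℝ (Fin m)} (hz : z ∈ Ω)
    (v : criticalSpace ι ((extChartAt (𝓡 m) x₀).symm z)) (w a : EuclideanSpace ℝ (Fin m))
    (u : (criticalSpace ι ((extChartAt (𝓡 m) x₀).symm z))ᗮ) (hu : (u : E) = A z a) :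
    ⟪shapeOperator ι ((extChartAt (𝓡 m) x₀).symm z)
      (mfderiv 𝓘(ℝ, EuclideanSpace ℝ (Fin m)) (𝓡 m) (extChartAt (𝓡 m) x₀).symm z w) u, v⟫_ℝ =
      ⟪fderiv ℝ A z w a, (v : E)⟫_ℝ := by
  obtain ⟨s, hsd, hsz, hsw⟩ := h.exists_section hz a
  obtain rfl : u = s _ := Subtype.ext (hu.trans hsz.symm)
  refine (congrArg (fun t ↦ ⟪t, v⟫_ℝ) (shapeOperator_section hι _ _ s hsd)).trans ?_
  refine (congrArg (fun t ↦ ⟪(criticalSpace ι _).orthogonalProjectionOnto t, v⟫_ℝ) (hsw w)).trans ?_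
  exact Submodule.inner_orthogonalProjectionOnto_eq_of_mem_right _ _

variable [RiemannianBundle (fun x : M ↦ TangentSpace (𝓡 m) x)]

/-- The shape operator in coordinates: the Riemannian volume density cancels against the choice of
orthonormal bases of the tangent spaces. -/
theorem volumeDensity_mul_absDetShape (h : IsCriticalFrame ι x₀ A B Ω) (hι : IsAmple ι)
    {z : EuclideanSpace ℝ (Fin m)} (hz : z ∈ Ω)
    (v : criticalSpace ι ((extChartAt (𝓡 m) x₀).symm z)) :
    volumeDensity x₀ z * absDetShape hι ((extChartAt (𝓡 m) x₀).symm z) v =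
      |(frameMatrix A z (v : E)).det| := by
  obtain ⟨L, hL⟩ := exists_linearIsometryEquiv_of_range_eq (A z) (h.norm_left z hz) _
    (h.range_left z hz)
  let u := (EuclideanSpace.basisFun (Fin m) ℝ).map L
  let e : OrthonormalBasis (Fin m) ℝ (TangentSpace (𝓡 m) ((extChartAt (𝓡 m) x₀).symm z)) :=
    tangentBasis ((extChartAt (𝓡 m) x₀).symm z)
  rw [absDetShape_eq hι _ v e u, volumeDensity, sqrt_det_gram_eq_abs_det e, ← abs_mul,
    ← Matrix.det_mul]
  congr 2
  -- Expanding `∂_i` in the basis `e` identifies the matrix product with `⟪Ξ(∂_i, u_j), v⟫`, which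
  -- is the frame matrix.
  ext i j
  have hu : ((u j : (criticalSpace ι ((extChartAt (𝓡 m) x₀).symm z))ᗮ) : E) =
      A z (EuclideanSpace.single j 1) := by
    rw [← hL, ← EuclideanSpace.basisFun_apply]
    exact congrArg Subtype.val ((EuclideanSpace.basisFun (Fin m) ℝ).map_apply L j)
  have h1 := h.inner_shapeOperator hι hz v (EuclideanSpace.single i 1) _ (u j) hu
  rw [Matrix.mul_apply, frameMatrix, Matrix.of_apply, ← h1]
  change _ = ⟪shapeOperator ι _ (coordField x₀ z i) (u j), v⟫_ℝ
  exact (inner_apply_eq_sum (shapeOperator ι _) e (coordField x₀ z i) (u j) v).symm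

end IsCriticalFrame

end Charts

/-! ### The expected number of critical points -/

section PuncturedBall

variable {F : Type*} [NormedAddCommGroup F] [InnerProductSpace ℝ F] [FiniteDimensional ℝ F]
  [MeasurableSpace F] [BorelSpace F]

/-- The integral over the punctured unit ball of a Euclidean space. -/
noncomputable def ballLIntegral (g : F → ℝ≥0∞) : ℝ≥0∞ := ∫⁻ v in ball (0 : F) 1 \ {0}, g v

theorem lintegral_sphereMeasure_eq {g : F → ℝ≥0∞} {k : ℕ}
    (hom : ∀ r : ℝ, 0 < r → ∀ v, g (r • v) = ENNReal.ofReal (r ^ k) * g v)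
    (hg : Measurable g) :
    ∫⁻ v : sphere (0 : F) 1, g v ∂sphereMeasure F =
      ((Module.finrank ℝ F + k : ℕ) : ℝ≥0∞) * ballLIntegral g :=
  (lintegral_toSphere_of_homogeneous volume hom hg.aemeasurable).2

theorem ballLIntegral_comp {W : Type*} [NormedAddCommGroup W] [InnerProductSpace ℝ W]
    [FiniteDimensional ℝ W] [MeasurableSpace W] [BorelSpace W] (L : W ≃ₗᵢ[ℝ] F)
    (g : F → ℝ≥0∞) : ballLIntegral g = ballLIntegral fun c ↦ g (L c) := by
  have h : L ⁻¹' (ball (0 : F) 1 \ {0}) = ball (0 : W) 1 \ {0} := by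
    ext c
    simp
  rw [ballLIntegral, ← L.measurePreserving.setLIntegral_comp_preimage_emb
    L.toHomeomorph.measurableEmbedding, h]
  rfl

theorem sphereMeasure_univ_eq : sphereMeasure F univ = unitSphereArea (Module.finrank ℝ F) := by
  have h := (stdOrthonormalBasis ℝ F).repr.measurePreserving.measure_preimage
    (measurableSet_ball (x := 0) (ε := 1)).nullMeasurableSet
  rw [LinearIsometryEquiv.preimage_ball, map_zero] at h
  rw [unitSphereArea, sphereMeasure, sphereMeasure, Measure.toSphere_apply_univ,
    Measure.toSphere_apply_univ, h, finrank_euclideanSpace_fin]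

end PuncturedBall

/-! ### The formula near a point and over the whole manifold -/

section Critical

variable {m : ℕ} {M : Type*} [TopologicalSpace M] [ChartedSpace (EuclideanSpace ℝ (Fin m)) M]
  {E : Type*} [NormedAddCommGroup E] [InnerProductSpace ℝ E]

theorem numCritical_smul (ι : E →ₗ[ℝ] C^∞⟮𝓡 m, M; ℝ⟯) {r : ℝ} (hr : r ≠ 0) (v : E) :
    numCritical ι (r • v) = numCritical ι v := by
  simp only [numCritical, Submodule.smul_mem_iff _ hr]

variable [FiniteDimensional ℝ E] {ι : E →ₗ[ℝ] C^∞⟮𝓡 m, M; ℝ⟯}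
  [RiemannianBundle (fun x : M ↦ TangentSpace (𝓡 m) x)]

theorem absDetShape_smul (hι : IsAmple ι) (x : M) {r : ℝ} (hr : 0 < r) (v : criticalSpace ι x) :
    absDetShape hι x (r • v) = r ^ m * absDetShape hι x v := by
  unfold absDetShape
  have h : ∀ (e : OrthonormalBasis (Fin m) ℝ (TangentSpace (𝓡 m) x))
      (u : OrthonormalBasis (Fin m) ℝ (criticalSpace ι x)ᗮ),
      shapeMatrix ι x e u (r • v) = r • shapeMatrix ι x e u v := by
    intro e u
    ext i j
    simp [shapeMatrix, inner_smul_right]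
  rw [h, Matrix.det_smul, abs_mul, Fintype.card_fin, abs_of_pos (pow_pos hr m)]

theorem continuous_absDetShape (hι : IsAmple ι) (x : M) : Continuous (absDetShape hι x) := by
  unfold absDetShape
  refine continuous_abs.comp (Continuous.matrix_det ?_)
  refine continuous_pi fun i ↦ continuous_pi fun j ↦ ?_
  exact continuous_const.inner continuous_subtype_val

variable [MeasurableSpace E] [BorelSpace E]

/-- Homogeneity of degree `m` on a space of dimension `N - m` gives the constant `N`, independent of
`x` and equal to the one for the count on the whole space. -/
theorem lintegral_sphere_absDetShape (hι : IsAmple ι) (x : M) :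
    ∫⁻ v, ENNReal.ofReal (absDetShape hι x v) ∂(sphereMeasure (criticalSpace ι x)) =
      (Module.finrank ℝ E : ℝ≥0∞) *
        ballLIntegral fun v ↦ ENNReal.ofReal (absDetShape hι x v) := by
  rw [← hι.finrank_criticalSpace_add x]
  refine lintegral_sphereMeasure_eq (fun r hr v ↦ ?_)
    (ENNReal.measurable_ofReal.comp (continuous_absDetShape hι x).measurable)
  rw [Function.comp_apply, absDetShape_smul hι x hr, ENNReal.ofReal_mul (pow_nonneg hr.le m)]
  rfl

/-- The isometry `B z` carries the ball of `K_x` to a fixed Euclidean ball, which matches the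
incidence formula. -/
theorem IsCriticalFrame.ofReal_volumeDensity_mul_ballLIntegral [IsManifold (𝓡 m) ∞ M]
    {x₀ : M} {n : ℕ}
    {A : EuclideanSpace ℝ (Fin m) → EuclideanSpace ℝ (Fin m) →L[ℝ] E}
    {B : EuclideanSpace ℝ (Fin m) → EuclideanSpace ℝ (Fin n) →L[ℝ] E}
    {Ω : Set (EuclideanSpace ℝ (Fin m))} (h : IsCriticalFrame ι x₀ A B Ω) (hι : IsAmple ι)
    {z : EuclideanSpace ℝ (Fin m)} (hz : z ∈ Ω) :
    ENNReal.ofReal (volumeDensity x₀ z) * ballLIntegral (fun v ↦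
      ENNReal.ofReal (absDetShape hι ((extChartAt (𝓡 m) x₀).symm z) v)) =
      ∫⁻ c in ball 0 1 \ {0}, ENNReal.ofReal |(frameMatrix A z (B z c)).det| := by
  obtain ⟨L, hL⟩ := exists_linearIsometryEquiv_of_range_eq (B z) (h.norm_right z hz) _
    (h.range_right z hz)
  rw [ballLIntegral_comp L, ballLIntegral, ← lintegral_const_mul' _ _ ENNReal.ofReal_ne_top]
  refine lintegral_congr fun c ↦ ?_
  rw [← ENNReal.ofReal_mul (p := volumeDensity x₀ z) (Real.sqrt_nonneg _),
    h.volumeDensity_mul_absDetShape hι hz, hL]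

variable [MeasurableSpace M]

/-- The local form of the theorem: the formula for the critical points in `A`. -/
structure CriticalFormula (hι : IsAmple ι) (A : Set M) : Prop where
  aemeasurable_left : AEMeasurable (fun v ↦ ({x ∈ A | v ∈ criticalSpace ι x}.encard : ℝ≥0∞))
    ((volume : Measure E).restrict (ball 0 1 \ {0}))
  aemeasurable_right : AEMeasurable (fun x ↦ ballLIntegral fun v ↦
    ENNReal.ofReal (absDetShape hι x v)) ((riemannianVolume m M).restrict A)
  lt_top : (ballLIntegral fun v ↦ ({x ∈ A | v ∈ criticalSpace ι x}.encard : ℝ≥0∞)) < ⊤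
  eq : (ballLIntegral fun v ↦ ({x ∈ A | v ∈ criticalSpace ι x}.encard : ℝ≥0∞)) =
    ∫⁻ x in A, (ballLIntegral fun v ↦ ENNReal.ofReal (absDetShape hι x v)) ∂riemannianVolume m M

theorem criticalFormula_empty (hι : IsAmple ι) : CriticalFormula hι ∅ := by
  constructor <;> simp [ballLIntegral]

theorem CriticalFormula.union {hι : IsAmple ι} {A A' : Set M} (h : CriticalFormula hι A)
    (h' : CriticalFormula hι A') (hA' : MeasurableSet A') (hd : Disjoint A A') :
    CriticalFormula hι (A ∪ A') := by
  have hcount : ∀ v : E, ({x ∈ A ∪ A' | v ∈ criticalSpace ι x}.encard : ℝ≥0∞) =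
      ({x ∈ A | v ∈ criticalSpace ι x}.encard : ℝ≥0∞) +
        ({x ∈ A' | v ∈ criticalSpace ι x}.encard : ℝ≥0∞) := by
    intro v
    have h1 : {x ∈ A ∪ A' | v ∈ criticalSpace ι x} =
        {x ∈ A | v ∈ criticalSpace ι x} ∪ {x ∈ A' | v ∈ criticalSpace ι x} := by
      ext x
      exact or_and_right
    rw [h1, encard_union_eq (hd.mono (fun x hx ↦ hx.1) (fun x hx ↦ hx.1)), ENat.toENNReal_add]
  have hsum : (ballLIntegral fun v ↦ ({x ∈ A ∪ A' | v ∈ criticalSpace ι x}.encard : ℝ≥0∞)) =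
      (ballLIntegral fun v ↦ ({x ∈ A | v ∈ criticalSpace ι x}.encard : ℝ≥0∞)) +
        ballLIntegral fun v ↦ ({x ∈ A' | v ∈ criticalSpace ι x}.encard : ℝ≥0∞) := by
    simp only [hcount]
    exact lintegral_add_left' h.aemeasurable_left _
  refine ⟨?_, ?_, ?_, ?_⟩
  · simp only [hcount]
    exact h.aemeasurable_left.add h'.aemeasurable_left
  · exact aemeasurable_union_iff.2 ⟨h.aemeasurable_right, h'.aemeasurable_right⟩
  · rw [hsum]
    exact ENNReal.add_lt_top.2 ⟨h.lt_top, h'.lt_top⟩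
  · rw [hsum, h.eq, h'.eq, lintegral_union hA' hd]

variable [IsManifold (𝓡 m) ∞ M] [BorelSpace M]
  [IsContMDiffRiemannianBundle (𝓡 m) ∞ (EuclideanSpace ℝ (Fin m))
    (fun x : M ↦ TangentSpace (𝓡 m) x)]

/-- The incidence formula in a chart. It is obtained for all measurable subsets of `W` so that
overlapping neighbourhoods can later be cut into disjoint pieces. -/
theorem IsAmple.exists_nhds_criticalFormula (hι : IsAmple ι) (x₀ : M) :
    ∃ W : Set M, IsOpen W ∧ x₀ ∈ W ∧ ∀ A ⊆ W, MeasurableSet A → CriticalFormula hι A := by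
  obtain ⟨n, hn⟩ : ∃ n, Module.finrank ℝ E = m + n :=
    ⟨Module.finrank ℝ (criticalSpace ι x₀), by rw [← hι.finrank_criticalSpace_add x₀, add_comm]⟩
  obtain ⟨r, hr, A, B, h⟩ := hι.exists_isCriticalFrame x₀ hn
  set φ := extChartAt (𝓡 m) x₀ with hφ
  -- Half the radius leaves a compact ball inside the domain of the frames, as finiteness requires.
  have hr2 : closedBall (φ x₀) (r / 2) ⊆ ball (φ x₀) r := closedBall_subset_ball (by linarith)
  refine ⟨φ.source ∩ φ ⁻¹' ball (φ x₀) (r / 2),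
    (continuousOn_extChartAt x₀).isOpen_inter_preimage (isOpen_extChartAt_source x₀) isOpen_ball,
    ⟨mem_extChartAt_source x₀, mem_ball_self (by linarith)⟩, fun S hS hSm ↦ ?_⟩
  set s := φ.target ∩ φ.symm ⁻¹' S with hs
  have hsm : MeasurableSet s := measurableSet_target_inter_preimage (m := m) x₀ hSm
  have hsC : s ⊆ closedBall (φ x₀) (r / 2) := by
    rintro z ⟨hz, hzS⟩
    have := (hS hzS).2
    rw [mem_preimage, φ.right_inv hz] at this
    exact ball_subset_closedBall this
  have hsΩ : s ⊆ ball (φ x₀) r := hsC.trans hr2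
  have hcount : ∀ v : E, ({z ∈ s | v ∈ range (B z)}.encard : ℝ≥0∞) =
      ({x ∈ S | v ∈ criticalSpace ι x}.encard : ℝ≥0∞) := by
    intro v
    have himg : φ.symm '' {z ∈ s | v ∈ range (B z)} = {x ∈ S | v ∈ criticalSpace ι x} := by
      have hB : ∀ z ∈ s, v ∈ range (B z) ↔ v ∈ criticalSpace ι (φ.symm z) := by
        intro z hz
        rw [← h.range_right z (hsΩ hz)]
        rfl
      ext x
      constructor
      · rintro ⟨z, ⟨hz, hv⟩, rfl⟩
        exact ⟨hz.2, (hB z hz).1 hv⟩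
      · rintro ⟨hx, hv⟩
        have hxs := (hS hx).1
        have hz : φ x ∈ s := ⟨φ.map_source hxs, by rwa [mem_preimage, φ.left_inv hxs]⟩
        exact ⟨φ x, ⟨hz, (hB _ hz).2 (by rwa [φ.left_inv hxs])⟩, φ.left_inv hxs⟩
    rw [← himg, InjOn.encard_image]
    exact φ.symm.injOn.mono fun z hz ↦ hz.1.1
  obtain ⟨h1, h2⟩ := h.toIsFramePair.lintegral_encard hsm hsΩ
  obtain ⟨h3, h4⟩ := lintegral_riemannianVolume x₀ hSm (fun x hx ↦ (hS hx).1)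
    (g := fun x ↦ ballLIntegral fun v ↦ ENNReal.ofReal (absDetShape hι x v))
    (fun z hz ↦ h.ofReal_volumeDensity_mul_ballLIntegral hι (hsΩ hz))
    (h.toIsFramePair.aemeasurable_lintegral hsm hsΩ)
  simp only [hcount] at h1 h2
  refine ⟨h1, h3, ?_, h2.trans h4.symm⟩
  refine h2.trans_lt (lt_of_le_of_lt (lintegral_mono_set hsC)
    (h.toIsFramePair.lintegral_lt_top (isCompact_closedBall _ _) hr2))

/-- Compactness induction. The property is hereditary for measurable subsets, so a set inside `S ∪
S'` splits into disjoint parts inside `S` and `S'`, and the formula is additive over these. -/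
theorem IsAmple.criticalFormula_univ [CompactSpace M] (hι : IsAmple ι) :
    CriticalFormula hι univ := by
  have key : ∃ S : Set M, univ ⊆ S ∧ MeasurableSet S ∧
      ∀ A ⊆ S, MeasurableSet A → CriticalFormula hι A := by
    refine isCompact_univ.induction_on (p := fun T : Set M ↦ ∃ S : Set M, T ⊆ S ∧
      MeasurableSet S ∧ ∀ A ⊆ S, MeasurableSet A → CriticalFormula hι A) ?_ ?_ ?_ ?_
    · refine ⟨∅, subset_rfl, MeasurableSet.empty, fun A hA _ ↦ ?_⟩
      rw [subset_empty_iff.1 hA]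
      exact criticalFormula_empty hι
    · rintro T T' hT ⟨S, hS, h⟩
      exact ⟨S, hT.trans hS, h⟩
    · rintro T T' ⟨S, hS, hSm, h⟩ ⟨S', hS', hSm', h'⟩
      refine ⟨S ∪ S', union_subset_union hS hS', hSm.union hSm', fun A hA hAm ↦ ?_⟩
      rw [← inter_union_sdiff A S]
      refine (h _ inter_subset_right (hAm.inter hSm)).union
        (h' _ (fun x hx ↦ (hA hx.1).resolve_left hx.2) (hAm.diff hSm)) (hAm.diff hSm) ?_
      exact disjoint_sdiff_inter.symm
    · intro x _
      obtain ⟨W, hW, hxW, h⟩ := hι.exists_nhds_criticalFormula x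
      exact ⟨W, mem_nhdsWithin_of_mem_nhds (hW.mem_nhds hxW), W, subset_rfl, hW.measurableSet, h⟩
  obtain ⟨S, hS, -, h⟩ := key
  exact h univ hS MeasurableSet.univ

/-- The expected number of critical points of a random function of an ample family. -/
theorem IsAmple.expectedCritical_eq [CompactSpace M] (hι : IsAmple ι) :
    AEMeasurable (fun v : sphere (0 : E) 1 ↦ (numCritical ι (v : E) : ℝ≥0∞)) (sphereMeasure E) ∧
    AEMeasurable (fun x : M ↦ ∫⁻ v, ENNReal.ofReal (absDetShape hι x v)
      ∂(sphereMeasure (criticalSpace ι x))) (riemannianVolume m M) ∧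
    expectedCritical ι < ⊤ ∧
    expectedCritical ι = (unitSphereArea (Module.finrank ℝ E))⁻¹ *
      ∫⁻ x, (∫⁻ v, ENNReal.ofReal (absDetShape hι x v)
        ∂(sphereMeasure (criticalSpace ι x))) ∂(riemannianVolume m M) := by
  obtain ⟨h1, h2, h3, h4⟩ := hι.criticalFormula_univ
  have hn : ∀ v : E, ({x ∈ (univ : Set M) | v ∈ criticalSpace ι x}.encard : ℝ≥0∞) =
      numCritical ι v := by
    intro v
    simp [numCritical]
  simp only [hn] at h1 h3 h4
  rw [Measure.restrict_univ] at h2 h4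
  -- The count is unchanged by positive scaling, so `k = 0`.
  obtain ⟨h5, h6⟩ := lintegral_toSphere_of_homogeneous (volume : Measure E) (k := 0)
    (g := fun v ↦ (numCritical ι v : ℝ≥0∞))
    (fun r hr v ↦ by simp [numCritical_smul ι hr.ne']) h1
  simp only [lintegral_sphere_absDetShape]
  rw [add_zero] at h6
  have h7 : expectedCritical ι = (sphereMeasure E univ)⁻¹ * ((Module.finrank ℝ E : ℝ≥0∞) *
      ballLIntegral fun v ↦ (numCritical ι v : ℝ≥0∞)) := congrArg _ h6
  refine ⟨h5, h2.const_mul _, ?_, ?_⟩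
  · rw [h7]
    -- In dimension zero the sphere is empty and the inverse of its area is `⊤`, but it multiplies
    -- `0`.
    rcases Nat.eq_zero_or_pos (Module.finrank ℝ E) with h0 | h0
    · simp [h0]
    · have : Nontrivial E := Module.finrank_pos_iff.1 h0
      refine ENNReal.mul_lt_top (ENNReal.inv_lt_top.2 ?_)
        (ENNReal.mul_lt_top (ENNReal.natCast_lt_top _) h3)
      exact Measure.measure_univ_pos.2 (Measure.toSphere_ne_zero _)
  · rw [h7, h4, sphereMeasure_univ_eq, lintegral_const_mul'' _ h2]

end Critical

theorem theorem1p1 {m : ℕ} {M : Type*} [TopologicalSpace M]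
    [ChartedSpace (EuclideanSpace ℝ (Fin m)) M] [IsManifold (𝓡 m) ∞ M]
    [T2Space M] [CompactSpace M] [ConnectedSpace M] [MeasurableSpace M] [BorelSpace M]
    [RiemannianBundle (fun x : M ↦ TangentSpace (𝓡 m) x)]
    [IsContMDiffRiemannianBundle (𝓡 m) ∞ (EuclideanSpace ℝ (Fin m))
      (fun x : M ↦ TangentSpace (𝓡 m) x)]
    (V : Submodule ℝ C^∞⟮𝓡 m, M; ℝ⟯) [FiniteDimensional ℝ V] (h : InnerProductSpace.Core ℝ V)
    (hV : IsAmple (SampleSpace.incl V h)) :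
    AEMeasurable
      (fun v : sphere (0 : SampleSpace V h) 1 ↦
        (numCritical (SampleSpace.incl V h) (v : SampleSpace V h) : ℝ≥0∞))
      (sphereMeasure (SampleSpace V h)) ∧
    AEMeasurable
      (fun x : M ↦ ∫⁻ v, ENNReal.ofReal (absDetShape hV x v)
        ∂(sphereMeasure (criticalSpace (SampleSpace.incl V h) x)))
      (riemannianVolume m M) ∧
    expectedCritical (SampleSpace.incl V h) < ⊤ ∧
    expectedCritical (SampleSpace.incl V h) =
      (unitSphereArea (Module.finrank ℝ V))⁻¹ *
        ∫⁻ x, (∫⁻ v, ENNReal.ofReal (absDetShape hV x v)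
          ∂(sphereMeasure (criticalSpace (SampleSpace.incl V h) x))) ∂(riemannianVolume m M) := by
  exact hV.expectedCritical_eq
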